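/- Let $n\ge 1$, let $(\Omega,\mathcal F,\mathbf P)$ be a probability space with $\sigma$-algebras $\mathcal F_0\subseteq\mathcal F_1\subseteq\dots\subseteq\mathcal F_n\subseteq\mathcal F$, and let $(\xi_i)_{1\le i\le n}$ be a sequence of square integrable real martingale differences: $\xi_i$ is $\mathcal F_i$-measurable, $\mathbf E[\xi_i^2]<\infty$, and $\mathbf E[\xi_i\mid\mathcal F_{i-1}]=0$ a.s. Put $$X_n=\sum_{i=1}^n\xi_i,\qquad \langle X\rangle_n=\sum_{i=1}^n\mathbf E[\xi_i^2\mid\mathcal F_{i-1}],$$ let $F_{X_n}$ be the distribution function of $X_n$, let $\Phi$ be the standard normal distribution function, and let $\|F_{X_n}-\Phi\|_1=\int_{-\infty}^{\infty}|F_{X_n}(x)-\Phi(x)|\,dx$. For all real $t\ge1$ and $\rho>0$ there is a constant $C_{t,\rho}>0$, depending only on $t$ and $\rho$, such that the following holds for all $n$, $(\Omega,\mathcal F,\mathbf P)$, $(\mathcal F_i)$, $(\xi_i)$ as above and every $\varepsilon_n\in(0,\tfrac12]$. If $$\mathbf E\big[|\xi_i|^{2+\rho}\,\big|\,\mathcal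 F_{i-1}\big]\le\varepsilon_n^{\rho}\,\mathbf E\big[\xi_i^2\,\big|\,\mathcal F_{i-1}\big]\quad\text{a.s. for all } i=1,\dots,n,$$ then $$\|F_{X_n}-\Phi\|_1\le C_{t,\rho}\Big(\hat\varepsilon_n+\Big(\mathbf E|\langle X\rangle_n-1|^t+\mathbf E\max_{1\le i\le n}|\xi_i|^{2t}\Big)^{1/(2t)}\Big),$$ where $\hat\varepsilon_n=\varepsilon_n^{\rho}$ if $\rho\in(0,1)$ and $\hat\varepsilon_n=\varepsilon_n|\log\varepsilon_n|$ if $\rho\ge1$. (The right-hand side is $+\infty$ if $\mathbf E\max_i|\xi_i|^{2t}=\infty$.) -/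

import Mathlib

open MeasureTheory ProbabilityTheory
open scoped ENNReal

noncomputable section

namespace MartingaleCLT

variable {Ω : Type*} {m : MeasurableSpace Ω}

/-- The finite sequence `ξ 1, …, ξ n` is a sequence of square integrable martingale differences
with respect to the filtration `ℱ 0 ⊆ ℱ 1 ⊆ … ⊆ ℱ n`. (Only the indices up to `n` matter, and
the sigma-algebra `ℱ 0` may be nontrivial.) -/
structure IsMartingaleDifference (μ : Measure Ω) (ℱ : Filtration ℕ m) (n : ℕ)
    (ξ : ℕ → Ω → ℝ) : Prop where
  measurable : ∀ i ∈ Finset.Icc 1 n, Measurable[ℱ i] (ξ i)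
  sq_integrable : ∀ i ∈ Finset.Icc 1 n, MemLp (ξ i) 2 μ
  condExp_eq_zero : ∀ i ∈ Finset.Icc 1 n, μ[ξ i | ℱ (i - 1)] =ᵐ[μ] 0

/-- `X_n = ∑_{i=1}^n ξ_i`. -/
def partialSum (n : ℕ) (ξ : ℕ → Ω → ℝ) (ω : Ω) : ℝ :=
  ∑ i ∈ Finset.Icc 1 n, ξ i ω

/-- The conditional variance `⟨X⟩_n = ∑_{i=1}^n E[ξ_i² | ℱ_{i-1}]`. -/
def condVariance (μ : Measure Ω) (ℱ : Filtration ℕ m) (n : ℕ) (ξ : ℕ → Ω → ℝ) (ω : Ω) : ℝ :=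
  ∑ i ∈ Finset.Icc 1 n, (μ[fun ω' => ξ i ω' ^ 2 | ℱ (i - 1)]) ω

/-- The conditional moment condition: almost surely
`E[|ξ_i|^(2+ρ) | ℱ_{i-1}] ≤ ε^ρ E[ξ_i² | ℱ_{i-1}]` for all `i = 1, …, n`.
Both sides are conditional expectations of nonnegative functions with values in `[0, ∞]`,
so that no integrability of `|ξ_i|^(2+ρ)` has to be assumed. -/
def CondMomentBound (μ : Measure Ω) (ℱ : Filtration ℕ m) (n : ℕ) (ξ : ℕ → Ω → ℝ)
    (ρ ε : ℝ) : Prop :=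
  ∀ i ∈ Finset.Icc 1 n, ∀ᵐ ω ∂μ,
    (condLExp (ℱ (i - 1)) μ (fun ω' => ‖ξ i ω'‖ₑ ^ (2 + ρ))) ω ≤
      ENNReal.ofReal (ε ^ ρ) * (condLExp (ℱ (i - 1)) μ (fun ω' => ‖ξ i ω'‖ₑ ^ 2)) ω

/-- `ε̂ = ε^ρ` if `ρ ∈ (0, 1)`, and `ε̂ = ε |log ε|` if `ρ ≥ 1`. -/
def epsHat (ρ ε : ℝ) : ℝ :=
  if ρ < 1 then ε ^ ρ else ε * |Real.log ε|

/-- The Wasserstein-1 distance `‖F_X - Φ‖₁ = ∫ |F_X(x) - Φ(x)| dx ∈ [0, ∞]` between the law of `X`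
and the standard normal law. -/
def normalDist (μ : Measure Ω) (X : Ω → ℝ) : ℝ≥0∞ :=
  ∫⁻ x : ℝ, ENNReal.ofReal |cdf (μ.map X) x - cdf (gaussianReal 0 1) x|

end MartingaleCLT

end

/-!
The bound follows from Lindeberg's replacement method, run in the intrinsic time of the conditional
variance. The `L¹` distance of the distribution functions equals `E f(Z) - E f(X_n)` for a primitive
`f` of a measurable function with values in `[-1, 1]` (`exists_primitive_lintegral_cdf_sub`). Let
`u(x, s) = E f(x + s Z)` be its Gaussian average, and let `p = min ρ 1`.

Weighted arithmetic-geometric mean inequalities turn the moment condition into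
`E[|ξ_i|^(2+p) | ℱ_{i-1}] ≤ ε^p E[ξ_i² | ℱ_{i-1}]` and `E[ξ_i² | ℱ_{i-1}] ≤ ε²`. Stop the martingale
just before its conditional variance exceeds `1`; since that variance is predictable, so is the
stopping rule, and no padding by extra random variables is needed: with `V'_k ≤ 1` the stopped
conditional variance and `s_k² = 1 + ε² - V'_k`, one follows `E u(X'_k, s_k)`. By the semigroup
property (`integral_smooth_gauss`), each step exchanges `ξ_k` for an independent normal increment of
the same conditional variance, and the first and second order terms of both Taylor expansions cancel
in mean (`abs_integral_smooth_step_le`). The second derivative of `u` in `x` is Hölder continuous of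
order `p` with constant of order `s^(-(1+p))` (`abs_smooth_taylor_le`), so the errors add up to
`ε^p E ∑ (s_{k-1}² - s_k²) s_k^(-(1+p))`. This is `ε^p` times a Riemann sum for
`∫ r^(-(1+p)/2) dr` over `[ε², 1 + ε²]`, hence of order `epsHat` (`exists_sum_weight_le`).

What remains is `E |X_n - X'_n| + E s_n`. By orthogonality of martingale differences and because a
single step changes the conditional variance by at most `ε²`, this is at most a multiple of
`(E |⟨X⟩_n - 1|)^(1/2) + ε` (`HasBoundedVariances.integral_abs_add_remaining_le`), and Jensen's
inequality gives the moment of order `t`.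
-/

noncomputable section

namespace MartingaleCLT

/-! ### Gaussian averages of Lipschitz functions -/

/-- The primitive of `g` vanishing at the origin. -/
def primitive (g : ℝ → ℝ) (x : ℝ) : ℝ := ∫ t in (0 : ℝ)..x, g t

/-- The Gaussian average `E f(x + s Z)` of the primitive `f` of `g`. The smoothing parameter is the
standard deviation `s`, not the variance. -/
def smooth (g : ℝ → ℝ) (x s : ℝ) : ℝ := ∫ z, primitive g (x + s * z) ∂(gaussianReal 0 1)

/-- The first derivative in `x` of `smooth g x s` for `s > 0`. -/
def smoothDeriv (g : ℝ → ℝ) (x s : ℝ) : ℝ := ∫ z, g (x + s * z) ∂(gaussianReal 0 1)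

/-- The second derivative in `x` of `smooth g x s` for `s > 0`, in the form that results from
Gaussian integration by parts. -/
def smoothDerivTwo (g : ℝ → ℝ) (x s : ℝ) : ℝ := s⁻¹ * ∫ z, z * g (x + s * z) ∂(gaussianReal 0 1)

lemma integrable_id_gauss : Integrable (fun z : ℝ => z) (gaussianReal 0 1) :=
  (memLp_id_gaussianReal' 1 (by simp)).integrable le_rfl

lemma integrable_sq_gauss : Integrable (fun z : ℝ => z ^ 2) (gaussianReal 0 1) :=
  (memLp_id_gaussianReal' 2 (by simp)).integrable_sq

lemma integral_sq_gauss : ∫ z, z ^ 2 ∂(gaussianReal 0 1) = 1 := by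
  have h := variance_fun_id_gaussianReal (μ := 0) (v := 1)
  rw [variance_eq_integral (by fun_prop)] at h
  simpa using h

lemma integral_abs_gauss_le : ∫ z, |z| ∂(gaussianReal 0 1) ≤ 1 := by
  have h : ∫ z, |z| ∂(gaussianReal 0 1) ≤ ∫ z, (1 + z ^ 2) / 2 ∂(gaussianReal 0 1) := by
    refine integral_mono integrable_id_gauss.abs
      (((integrable_const _).add integrable_sq_gauss).div_const 2) fun z => ?_
    simp only
    nlinarith [sq_nonneg (|z| - 1), sq_abs z]
  rw [integral_div, integral_add (integrable_const _) integrable_sq_gauss, integral_sq_gauss] at h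
  simpa using h

lemma integrable_abs_rpow_gauss {p : ℝ} (hp : 0 < p) :
    Integrable (fun z : ℝ => |z| ^ p) (gaussianReal 0 1) := by
  have := (memLp_id_gaussianReal' (μ := 0) (v := 1) (ENNReal.ofReal p)
    (by simp)).integrable_norm_rpow (by simpa using hp) (by simp)
  simpa [ENNReal.toReal_ofReal hp.le] using this

section Primitive

variable {g : ℝ → ℝ}

lemma intervalIntegrable_of_bounded (hg : Measurable g) (hb : ∀ x, |g x| ≤ 1) (a b : ℝ) :
    IntervalIntegrable g volume a b :=
  (intervalIntegrable_const (c := (1 : ℝ))).mono_fun hg.aestronglyMeasurable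
    (ae_of_all _ fun x => by simpa using hb x)

lemma primitive_sub (hg : Measurable g) (hb : ∀ x, |g x| ≤ 1) (a b : ℝ) :
    primitive g b - primitive g a = ∫ t in a..b, g t :=
  intervalIntegral.integral_interval_sub_left (intervalIntegrable_of_bounded hg hb _ _)
    (intervalIntegrable_of_bounded hg hb _ _)

lemma abs_primitive_sub_le (hg : Measurable g) (hb : ∀ x, |g x| ≤ 1) (a b : ℝ) :
    |primitive g b - primitive g a| ≤ |b - a| := by
  rw [primitive_sub hg hb]
  simpa using intervalIntegral.norm_integral_le_of_norm_le_const (f := g) (a := a) (b := b) (C := 1)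
    (fun x _ => hb x)

lemma abs_primitive_le (hg : Measurable g) (hb : ∀ x, |g x| ≤ 1) (x : ℝ) :
    |primitive g x| ≤ |x| := by
  simpa [primitive] using abs_primitive_sub_le hg hb 0 x

lemma continuous_primitive (hg : Measurable g) (hb : ∀ x, |g x| ≤ 1) :
    Continuous (primitive g) :=
  (LipschitzWith.of_dist_le_mul (K := 1) fun x y => by
    simpa [Real.dist_eq] using abs_primitive_sub_le hg hb y x).continuous

lemma integrable_primitive_gauss (hg : Measurable g) (hb : ∀ x, |g x| ≤ 1) (x s : ℝ) :
    Integrable (fun z => primitive g (x + s * z)) (gaussianReal 0 1) := by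
  have hc := continuous_primitive hg hb
  refine Integrable.mono' (((integrable_const |x|).add (integrable_id_gauss.abs.const_mul |s|)))
    (by fun_prop) (ae_of_all _ fun z => ?_)
  refine (abs_primitive_le hg hb _).trans ((abs_add_le _ _).trans ?_)
  simp [abs_mul]

lemma measurable_smooth (hg : Measurable g) (hb : ∀ x, |g x| ≤ 1) :
    Measurable fun p : ℝ × ℝ => smooth g p.1 p.2 := by
  have hc := continuous_primitive hg hb
  have : StronglyMeasurable (fun q : (ℝ × ℝ) × ℝ => primitive g (q.1.1 + q.1.2 * q.2)) :=
    (hc.measurable.comp (by fun_prop)).stronglyMeasurable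
  exact this.integral_prod_right'.measurable

lemma measurable_smoothDeriv (hg : Measurable g) :
    Measurable fun p : ℝ × ℝ => smoothDeriv g p.1 p.2 := by
  have : StronglyMeasurable (fun q : (ℝ × ℝ) × ℝ => g (q.1.1 + q.1.2 * q.2)) :=
    (hg.comp (by fun_prop)).stronglyMeasurable
  exact this.integral_prod_right'.measurable

lemma measurable_smoothDerivTwo (hg : Measurable g) :
    Measurable fun p : ℝ × ℝ => smoothDerivTwo g p.1 p.2 := by
  have : StronglyMeasurable (fun q : (ℝ × ℝ) × ℝ => q.2 * g (q.1.1 + q.1.2 * q.2)) :=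
    (measurable_snd.mul (hg.comp (by fun_prop))).stronglyMeasurable
  exact measurable_snd.inv.mul this.integral_prod_right'.measurable

lemma abs_smooth_sub_le (hg : Measurable g) (hb : ∀ x, |g x| ≤ 1) (x y s r : ℝ) :
    |smooth g x s - smooth g y r| ≤ |x - y| + |s - r| := by
  unfold smooth
  rw [← integral_sub (integrable_primitive_gauss hg hb _ _) (integrable_primitive_gauss hg hb _ _)]
  have hi : Integrable (fun z : ℝ => |x - y| + |s - r| * |z|) (gaussianReal 0 1) :=
    (integrable_const _).add (integrable_id_gauss.abs.const_mul _)
  rw [← Real.norm_eq_abs]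
  refine (norm_integral_le_of_norm_le hi (ae_of_all _ fun z => ?_)).trans ?_
  · refine (abs_primitive_sub_le hg hb _ _).trans ?_
    rw [← abs_mul]
    refine le_trans (le_of_eq ?_) (abs_add_le _ _)
    ring_nf
  · rw [integral_add (integrable_const _) (integrable_id_gauss.abs.const_mul _),
      integral_const_mul]
    simp only [integral_const, probReal_univ, smul_eq_mul, one_mul]
    gcongr
    exact mul_le_of_le_one_right (abs_nonneg _) integral_abs_gauss_le

lemma smooth_zero_right (x : ℝ) : smooth g x 0 = primitive g x := by simp [smooth]

lemma abs_smoothDeriv_le (hb : ∀ x, |g x| ≤ 1) (x s : ℝ) : |smoothDeriv g x s| ≤ 1 := by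
  simpa [smoothDeriv] using norm_integral_le_of_norm_le_const (μ := gaussianReal 0 1) (C := 1)
    (f := fun z => g (x + s * z)) (ae_of_all _ fun z => hb (x + s * z))

lemma abs_integral_mul_gauss_le (hb : ∀ x, |g x| ≤ 1) (x s : ℝ) :
    |∫ z, z * g (x + s * z) ∂(gaussianReal 0 1)| ≤ 1 := by
  rw [← Real.norm_eq_abs]
  refine (norm_integral_le_of_norm_le integrable_id_gauss.abs (ae_of_all _ fun z => ?_)).trans
    integral_abs_gauss_le
  rw [Real.norm_eq_abs, abs_mul]
  exact mul_le_of_le_one_right (abs_nonneg _) (hb _)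

lemma abs_smoothDerivTwo_le (hb : ∀ x, |g x| ≤ 1) (x : ℝ) {s : ℝ} (hs : 0 < s) :
    |smoothDerivTwo g x s| ≤ s⁻¹ := by
  rw [smoothDerivTwo, abs_mul, abs_of_pos (inv_pos.2 hs)]
  exact mul_le_of_le_one_right (inv_pos.2 hs).le (abs_integral_mul_gauss_le hb x s)

/-- The Gaussian averages form a semigroup in the variance. -/
lemma integral_smooth_gauss (hg : Measurable g) (hb : ∀ x, |g x| ≤ 1) (x a s : ℝ) :
    ∫ z, smooth g (x + a * z) s ∂(gaussianReal 0 1) = smooth g x (√(a ^ 2 + s ^ 2)) := by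
  have hc := continuous_primitive hg hb
  have hmap : ∀ c : ℝ, (gaussianReal 0 1).map (fun z => c * z) =
      gaussianReal 0 (NNReal.mk (c ^ 2) (sq_nonneg c)) := fun c => by
    rw [gaussianReal_map_const_mul]
    simp
  have key : ∀ c y : ℝ, smooth g y c =
      ∫ w, primitive g (y + w) ∂(gaussianReal 0 (NNReal.mk (c ^ 2) (sq_nonneg c))) := fun c y => by
    rw [← hmap, integral_map (by fun_prop) (by fun_prop)]
    rfl
  have hint : ∀ v, Integrable (fun w => primitive g (x + w)) (gaussianReal 0 v) := fun v => by
    refine Integrable.mono' ((integrable_const |x|).add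
      ((memLp_id_gaussianReal' (μ := 0) (v := v) 1 (by simp)).integrable le_rfl).abs)
      (by fun_prop) (ae_of_all _ fun z => ?_)
    exact (abs_primitive_le hg hb _).trans (abs_add_le _ _)
  have hsq : NNReal.mk (√(a ^ 2 + s ^ 2) ^ 2) (sq_nonneg _) =
      NNReal.mk (a ^ 2) (sq_nonneg a) + NNReal.mk (s ^ 2) (sq_nonneg s) := by
    ext
    simp [Real.sq_sqrt (add_nonneg (sq_nonneg a) (sq_nonneg s))]
  have hconv : gaussianReal 0 (NNReal.mk (a ^ 2) (sq_nonneg a) + NNReal.mk (s ^ 2) (sq_nonneg s)) =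
      (gaussianReal 0 (NNReal.mk (a ^ 2) (sq_nonneg a))).conv
        (gaussianReal 0 (NNReal.mk (s ^ 2) (sq_nonneg s))) := by
    rw [gaussianReal_conv_gaussianReal, add_zero]
  rw [key (√(a ^ 2 + s ^ 2)) x, hsq, hconv, integral_conv]
  · rw [← hmap a, integral_map (by fun_prop) ?_]
    · refine integral_congr_ae (ae_of_all _ fun z => ?_)
      simp only [key s, add_assoc]
    · refine StronglyMeasurable.aestronglyMeasurable ?_
      have : StronglyMeasurable (fun q : ℝ × ℝ => primitive g (x + (q.1 + q.2))) :=
        (hc.measurable.comp (by fun_prop)).stronglyMeasurable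
      exact this.integral_prod_right'
  · rw [← hconv]
    exact hint _

end Primitive

/-! ### Taylor expansion of the Gaussian averages -/

/-- Minkowski's inequality in `L¹` for an integral over the interval between `0` and `c`. -/
lemma lintegral_enorm_intervalIntegral_le {F : ℝ → ℝ → ℝ} (hF : Continuous F.uncurry) (c : ℝ)
    {B : ℝ≥0∞} (hB : ∀ t ∈ Set.uIoc 0 c, ∫⁻ z, ‖F t z‖ₑ ≤ B) :
    ∫⁻ z, ‖∫ t in (0 : ℝ)..c, F t z‖ₑ ≤ ENNReal.ofReal |c| * B := by
  have h1 : ∀ z, ‖∫ t in (0 : ℝ)..c, F t z‖ₑ ≤ ∫⁻ t in Set.uIoc 0 c, ‖F t z‖ₑ := fun z => by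
    rw [← ofReal_norm, intervalIntegral.norm_integral_eq_norm_integral_uIoc,
      ofReal_norm]
    exact enorm_integral_le_lintegral_enorm _
  have hm : Measurable (fun p : ℝ × ℝ => ‖F p.2 p.1‖ₑ) :=
    (hF.comp continuous_swap).measurable.enorm
  calc ∫⁻ z, ‖∫ t in (0 : ℝ)..c, F t z‖ₑ
      ≤ ∫⁻ z, ∫⁻ t in Set.uIoc 0 c, ‖F t z‖ₑ := lintegral_mono h1
    _ = ∫⁻ t in Set.uIoc 0 c, ∫⁻ z, ‖F t z‖ₑ := lintegral_lintegral_swap hm.aemeasurable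
    _ ≤ ∫⁻ _ in Set.uIoc 0 c, B := setLIntegral_mono measurable_const hB
    _ = ENNReal.ofReal |c| * B := by
      rw [setLIntegral_const, Real.volume_uIoc, sub_zero, mul_comm]

lemma lintegral_translate_sub_le {K K' : ℝ → ℝ} (hK : ∀ x, HasDerivAt K (K' x) x)
    (hK' : Continuous K') (c : ℝ) :
    ∫⁻ z, ‖K (z - c) - K z‖ₑ ≤ ENNReal.ofReal |c| * ∫⁻ z, ‖K' z‖ₑ := by
  have h : ∀ z, K (z - c) - K z = ∫ t in (0 : ℝ)..c, -K' (z - t) := fun z => by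
    rw [intervalIntegral.integral_eq_sub_of_hasDerivAt (f := fun t => K (z - t))]
    · simp
    · intro t _
      have : HasDerivAt (fun t => K (z - t)) (-(1 : ℝ) • K' (z - t)) t :=
        (hK (z - t)).scomp t ((hasDerivAt_id t).const_sub z)
      simpa using this
    · exact (by fun_prop : Continuous fun t => -K' (z - t)).intervalIntegrable _ _
  simp_rw [h]
  refine lintegral_enorm_intervalIntegral_le (by fun_prop) c fun t _ => ?_
  simp only [enorm_neg]
  exact (lintegral_sub_right_eq_self (fun z => ‖K' z‖ₑ) t).le

lemma lintegral_translate_taylor_le {K K' K'' : ℝ → ℝ} (hK : ∀ x, HasDerivAt K (K' x) x)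
    (hK' : ∀ x, HasDerivAt K' (K'' x) x) (hK'' : Continuous K'') (c : ℝ) :
    ∫⁻ z, ‖K (z - c) - K z + c * K' z‖ₑ ≤
      ENNReal.ofReal |c| * (ENNReal.ofReal |c| * ∫⁻ z, ‖K'' z‖ₑ) := by
  have hc : Continuous K' := continuous_iff_continuousAt.2 fun x => (hK' x).continuousAt
  have h : ∀ z, K (z - c) - K z + c * K' z = ∫ t in (0 : ℝ)..c, -(K' (z - t) - K' z) := fun z => by
    rw [intervalIntegral.integral_eq_sub_of_hasDerivAt (f := fun t => K (z - t) + t * K' z)]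
    · simp
      ring
    · intro t _
      have : HasDerivAt (fun t => K (z - t) + t * K' z) (-(1 : ℝ) • K' (z - t) + 1 * K' z) t :=
        ((hK (z - t)).scomp t ((hasDerivAt_id t).const_sub z)).add
          ((hasDerivAt_id t).mul_const (K' z))
      refine this.congr_deriv ?_
      simp only [smul_eq_mul]
      ring
    · exact (by fun_prop : Continuous fun t => -(K' (z - t) - K' z)).intervalIntegrable _ _
  simp_rw [h]
  refine lintegral_enorm_intervalIntegral_le (by fun_prop) c fun t ht => ?_
  simp only [enorm_neg]
  refine (lintegral_translate_sub_le hK' hK'' t).trans ?_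
  refine mul_le_mul_left (ENNReal.ofReal_le_ofReal ?_) _
  simpa using Set.abs_sub_left_of_mem_uIcc (Set.uIoc_subset_uIcc ht)

lemma hasDerivAt_gaussianPDFReal (x : ℝ) :
    HasDerivAt (gaussianPDFReal 0 1) (-x * gaussianPDFReal 0 1 x) x := by
  have h : HasDerivAt (fun x : ℝ => -(x - 0) ^ 2 / (2 * ((1 : NNReal) : ℝ))) (-x) x := by
    have : HasDerivAt (fun x : ℝ => -(x - 0) ^ 2 / (2 * ((1 : NNReal) : ℝ)))
        (-((2 : ℕ) * (x - 0) ^ (2 - 1) * 1) / (2 * ((1 : NNReal) : ℝ))) x :=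
      ((((hasDerivAt_id x).sub_const 0).pow 2).neg).div_const (2 * ((1 : NNReal) : ℝ))
    convert this using 1
    norm_num
    ring
  have := (h.exp).const_mul ((√(2 * Real.pi * ((1 : NNReal) : ℝ)))⁻¹)
  rw [gaussianPDFReal_def]
  refine this.congr_deriv ?_
  ring

lemma hasDerivAt_neg_mul_gaussianPDFReal (x : ℝ) :
    HasDerivAt (fun y => -y * gaussianPDFReal 0 1 y) ((x ^ 2 - 1) * gaussianPDFReal 0 1 x) x := by
  refine ((hasDerivAt_id x).neg.mul (hasDerivAt_gaussianPDFReal x)).congr_deriv ?_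
  simp only [Pi.neg_apply, id_eq]
  ring

lemma continuous_gaussianPDFReal : Continuous (gaussianPDFReal 0 1) :=
  continuous_iff_continuousAt.2 fun x => (hasDerivAt_gaussianPDFReal x).continuousAt

lemma lintegral_mul_gaussianPDFReal {k : ℝ → ℝ} (hk : Measurable k)
    (hi : Integrable k (gaussianReal 0 1)) :
    ∫⁻ z, ‖k z * gaussianPDFReal 0 1 z‖ₑ = ENNReal.ofReal (∫ z, |k z| ∂(gaussianReal 0 1)) := by
  rw [ofReal_integral_eq_lintegral_ofReal hi.abs (ae_of_all _ fun _ => abs_nonneg _),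
    gaussianReal_of_var_ne_zero 0 one_ne_zero, lintegral_withDensity_eq_lintegral_mul _
      (measurable_gaussianPDF _ _) (by fun_prop)]
  refine lintegral_congr fun z => ?_
  rw [enorm_mul, mul_comm, Pi.mul_apply, gaussianPDF, Real.enorm_eq_ofReal_abs (k z),
    Real.enorm_eq_ofReal (gaussianPDFReal_nonneg _ _ _)]

lemma lintegral_deriv_gaussianPDFReal_le :
    ∫⁻ z, ‖-z * gaussianPDFReal 0 1 z‖ₑ ≤ ENNReal.ofReal 1 := by
  rw [lintegral_mul_gaussianPDFReal (k := fun z => -z) (by fun_prop) integrable_id_gauss.neg]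
  simp only [abs_neg]
  exact ENNReal.ofReal_le_ofReal integral_abs_gauss_le

lemma lintegral_deriv_two_gaussianPDFReal_le :
    ∫⁻ z, ‖(z ^ 2 - 1) * gaussianPDFReal 0 1 z‖ₑ ≤ ENNReal.ofReal 2 := by
  have hi := integrable_sq_gauss.sub (integrable_const (μ := gaussianReal 0 1) (1 : ℝ))
  rw [lintegral_mul_gaussianPDFReal (k := fun z => z ^ 2 - 1) (by fun_prop) hi]
  refine ENNReal.ofReal_le_ofReal ?_
  calc ∫ z, |z ^ 2 - 1| ∂(gaussianReal 0 1) ≤ ∫ z, (z ^ 2 + 1) ∂(gaussianReal 0 1) := by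
        refine integral_mono hi.abs (integrable_sq_gauss.add (integrable_const _)) fun z => ?_
        simp only [abs_le]
        constructor <;> nlinarith [sq_nonneg z]
    _ = 2 := by
        rw [integral_add integrable_sq_gauss (integrable_const _), integral_sq_gauss]
        norm_num

lemma abs_integral_mul_le_of_lintegral {g k : ℝ → ℝ} (hb : ∀ x, |g x| ≤ 1) {B : ℝ} (hB : 0 ≤ B)
    (hk : ∫⁻ z, ‖k z‖ₑ ≤ ENNReal.ofReal B) : |∫ z, g z * k z| ≤ B := by
  rw [← ENNReal.ofReal_le_ofReal_iff hB, ← Real.enorm_eq_ofReal_abs]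
  refine (enorm_integral_le_lintegral_enorm _).trans ((lintegral_mono fun z => ?_).trans hk)
  rw [enorm_mul]
  refine mul_le_of_le_one_left' ?_
  rw [Real.enorm_eq_ofReal_abs]
  exact ENNReal.ofReal_le_one.2 (hb z)

section Taylor

variable {g : ℝ → ℝ}

lemma smoothDeriv_eq_integral (x s : ℝ) :
    smoothDeriv g x s = ∫ z, g (x + s * z) * gaussianPDFReal 0 1 z := by
  simp only [smoothDeriv, integral_gaussianReal_eq_integral_smul one_ne_zero, smul_eq_mul,
    mul_comm]

lemma smoothDeriv_add_eq_integral (x t : ℝ) {s : ℝ} (hs : 0 < s) :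
    smoothDeriv g (x + t) s = ∫ z, g (x + s * z) * gaussianPDFReal 0 1 (z - t / s) := by
  rw [smoothDeriv_eq_integral,
    ← integral_sub_right_eq_self (fun z => g (x + t + s * z) * gaussianPDFReal 0 1 z) (t / s)]
  refine integral_congr_ae (ae_of_all _ fun z => ?_)
  have : x + t + s * (z - t / s) = x + s * z := by field_simp; ring
  simp only [this]

lemma integrable_mul_density (hg : Measurable g) (hb : ∀ x, |g x| ≤ 1) (x s : ℝ) {k : ℝ → ℝ}
    (hk : Integrable k) : Integrable fun z => g (x + s * z) * k z :=
  hk.bdd_mul (hg.comp (by fun_prop)).aestronglyMeasurable (ae_of_all _ fun z => hb _)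

lemma integrable_deriv_gaussianPDFReal : Integrable fun z => -z * gaussianPDFReal 0 1 z := by
  refine ⟨by fun_prop, lintegral_deriv_gaussianPDFReal_le.trans_lt (by simp)⟩

lemma abs_smoothDeriv_add_sub_le (hg : Measurable g) (hb : ∀ x, |g x| ≤ 1) (x t : ℝ) {s : ℝ}
    (hs : 0 < s) : |smoothDeriv g (x + t) s - smoothDeriv g x s| ≤ |t| / s := by
  have hi := integrable_gaussianPDFReal 0 1
  rw [smoothDeriv_add_eq_integral x t hs, smoothDeriv_eq_integral,
    ← integral_sub (integrable_mul_density hg hb x s (hi.comp_sub_right (t / s)))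
      (integrable_mul_density hg hb x s hi)]
  simp only [← mul_sub]
  refine abs_integral_mul_le_of_lintegral (g := fun z => g (x + s * z)) (fun z => hb _)
    (by positivity) ?_
  refine (lintegral_translate_sub_le hasDerivAt_gaussianPDFReal
    (continuous_id.neg.mul continuous_gaussianPDFReal) _).trans ?_
  refine (mul_le_mul_right lintegral_deriv_gaussianPDFReal_le _).trans ?_
  rw [← ENNReal.ofReal_mul (abs_nonneg _), abs_div, abs_of_pos hs, mul_one]

lemma abs_smoothDeriv_taylor_le (hg : Measurable g) (hb : ∀ x, |g x| ≤ 1) (x t : ℝ) {s : ℝ}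
    (hs : 0 < s) :
    |smoothDeriv g (x + t) s - smoothDeriv g x s - t * smoothDerivTwo g x s| ≤
      2 * (t ^ 2 / s ^ 2) := by
  have hi := integrable_gaussianPDFReal 0 1
  have h2 : t * smoothDerivTwo g x s =
      -∫ z, g (x + s * z) * (t / s * (-z * gaussianPDFReal 0 1 z)) := by
    rw [smoothDerivTwo, integral_gaussianReal_eq_integral_smul one_ne_zero, ← mul_assoc,
      ← integral_const_mul, ← integral_neg]
    refine integral_congr_ae (ae_of_all _ fun z => ?_)
    simp only [smul_eq_mul]
    field_simp
  have hd := integrable_mul_density hg hb x s ((hi.comp_sub_right (t / s)).sub hi)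
  simp only [Pi.sub_apply, mul_sub] at hd
  rw [h2, sub_neg_eq_add, smoothDeriv_add_eq_integral x t hs, smoothDeriv_eq_integral,
    ← integral_sub (integrable_mul_density hg hb x s (hi.comp_sub_right (t / s)))
      (integrable_mul_density hg hb x s hi), ← integral_add hd
      (integrable_mul_density hg hb x s (integrable_deriv_gaussianPDFReal.const_mul _))]
  simp only [← mul_sub, ← mul_add]
  refine abs_integral_mul_le_of_lintegral (g := fun z => g (x + s * z)) (fun z => hb _)
    (by positivity) ?_
  refine (lintegral_translate_taylor_le hasDerivAt_gaussianPDFReal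
    hasDerivAt_neg_mul_gaussianPDFReal
    (((continuous_id.pow 2).sub continuous_const).mul continuous_gaussianPDFReal) _).trans ?_
  grw [lintegral_deriv_two_gaussianPDFReal_le]
  rw [← ENNReal.ofReal_mul (abs_nonneg _), ← ENNReal.ofReal_mul (abs_nonneg _)]
  refine ENNReal.ofReal_le_ofReal (le_of_eq ?_)
  rw [← mul_assoc, abs_mul_abs_self]
  ring

lemma smooth_add_sub (hg : Measurable g) (hb : ∀ x, |g x| ≤ 1) (x h s : ℝ) :
    smooth g (x + h) s - smooth g x s = ∫ t in (0 : ℝ)..h, smoothDeriv g (x + t) s := by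
  unfold smooth smoothDeriv
  rw [intervalIntegral_integral_swap,
    ← integral_sub (integrable_primitive_gauss hg hb _ _) (integrable_primitive_gauss hg hb _ _)]
  · refine integral_congr_ae (ae_of_all _ fun z => ?_)
    simp only [primitive_sub hg hb]
    have := intervalIntegral.integral_comp_add_left (a := 0) (b := h) g (x + s * z)
    rw [add_zero] at this
    rw [show x + h + s * z = x + s * z + h by ring, ← this]
    refine intervalIntegral.integral_congr fun t _ => ?_
    rw [add_right_comm]
  · have : IsFiniteMeasure (volume.restrict (Set.uIoc 0 h)) := ⟨by simp [Real.volume_uIoc]⟩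
    exact Integrable.mono' (integrable_const 1) (hg.comp (by fun_prop)).aestronglyMeasurable
      (ae_of_all _ fun z => hb _)

/-- Second order Taylor expansion in `x` of `smooth g x s`, with a remainder that interpolates
between the bounds `h² / s` and `|h|³ / s²`. -/
lemma abs_smooth_taylor_le (hg : Measurable g) (hb : ∀ x, |g x| ≤ 1) (x h : ℝ) {s p : ℝ}
    (hs : 0 < s) (hp0 : 0 ≤ p) (hp1 : p ≤ 1) :
    |smooth g (x + h) s - smooth g x s - h * smoothDeriv g x s
      - h ^ 2 / 2 * smoothDerivTwo g x s| ≤ 2 * |h| ^ (2 + p) * s ^ (-(1 + p)) := by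
  set A : ℝ → ℝ := fun t =>
    smoothDeriv g (x + t) s - smoothDeriv g x s - t * smoothDerivTwo g x s with hA
  have hD : IntervalIntegrable (fun t => smoothDeriv g (x + t) s) volume 0 h :=
    (intervalIntegrable_const (c := (1 : ℝ))).mono_fun
      ((measurable_smoothDeriv hg).comp (by fun_prop : Measurable fun t => (x + t, s))
        ).aestronglyMeasurable
      (ae_of_all _ fun t => by simpa using abs_smoothDeriv_le hb (x + t) s)
  have hid : smooth g (x + h) s - smooth g x s - h * smoothDeriv g x s
      - h ^ 2 / 2 * smoothDerivTwo g x s = ∫ t in (0 : ℝ)..h, A t := by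
    rw [smooth_add_sub hg hb, hA, intervalIntegral.integral_sub
      (hD.sub intervalIntegrable_const) ((by fun_prop : Continuous fun t : ℝ =>
        t * smoothDerivTwo g x s).intervalIntegrable _ _),
      intervalIntegral.integral_sub hD intervalIntegrable_const,
      intervalIntegral.integral_const, intervalIntegral.integral_mul_const, integral_id]
    simp
  set y := |h| / s with hy
  have hy0 : 0 ≤ y := by positivity
  have hbd : ∀ t ∈ Set.uIoc 0 h, |A t| ≤ 2 * (y * y ^ p) := by
    intro t ht
    have hth : |t| ≤ |h| := by
      simpa using Set.abs_sub_left_of_mem_uIcc (Set.uIoc_subset_uIcc ht)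
    have hty : |t| / s ≤ y := by rw [hy]; gcongr
    have e1 : |A t| ≤ 2 * y := by
      have h1 := abs_smoothDeriv_add_sub_le hg hb x t hs
      have h2 := abs_smoothDerivTwo_le hb x hs
      have h3 : |t * smoothDerivTwo g x s| ≤ |t| / s := by
        rw [abs_mul, div_eq_mul_inv]
        gcongr
      linarith [abs_sub (smoothDeriv g (x + t) s - smoothDeriv g x s) (t * smoothDerivTwo g x s)]
    have e2 : |A t| ≤ 2 * (y * y) := by
      refine (abs_smoothDeriv_taylor_le hg hb x t hs).trans ?_
      rw [← sq_abs t, ← div_pow, ← sq]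
      gcongr
    rcases le_total y 1 with hy1 | hy1
    · refine e2.trans ?_
      gcongr
      simpa using Real.rpow_le_rpow_of_exponent_ge' hy0 hy1 hp0 hp1
    · refine e1.trans ?_
      gcongr
      exact le_mul_of_one_le_right hy0 (Real.one_le_rpow hy1 hp0)
  rw [hid, ← Real.norm_eq_abs]
  refine (intervalIntegral.norm_integral_le_of_norm_le_const hbd).trans (le_of_eq ?_)
  rw [sub_zero, hy, Real.div_rpow (abs_nonneg _) hs.le, Real.rpow_neg hs.le, Real.rpow_add hs,
    Real.rpow_one, Real.rpow_add_of_nonneg (abs_nonneg _) (by norm_num) hp0, Real.rpow_two]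
  field_simp

/-- The constant `E|Z|^(2+p)` for a standard normal `Z`. -/
def gaussMoment (p : ℝ) : ℝ := ∫ z, |z| ^ (2 + p) ∂(gaussianReal 0 1)

lemma gaussMoment_nonneg (p : ℝ) : 0 ≤ gaussMoment p :=
  integral_nonneg fun _ => Real.rpow_nonneg (abs_nonneg _) _

/-- Increasing the variance of the smoothing by `q` adds `q / 2` times the second derivative, up to
a remainder of order `2 + p` in the standard deviation `√q`. -/
lemma abs_smooth_sqrt_add_le (hg : Measurable g) (hb : ∀ x, |g x| ≤ 1) (x : ℝ) {q s p : ℝ}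
    (hq : 0 ≤ q) (hs : 0 < s) (hp0 : 0 ≤ p) (hp1 : p ≤ 1) :
    |smooth g x (√(q + s ^ 2)) - smooth g x s - q / 2 * smoothDerivTwo g x s| ≤
      2 * gaussMoment p * √q ^ (2 + p) * s ^ (-(1 + p)) := by
  have hsg := integral_smooth_gauss hg hb x (√q) s
  rw [Real.sq_sqrt hq] at hsg
  have hms := measurable_smooth hg hb
  have i1 : Integrable (fun z => smooth g (x + √q * z) s) (gaussianReal 0 1) := by
    refine Integrable.mono' (((integrable_id_gauss.abs.const_mul (√q))).add
      (integrable_const |smooth g x s|))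
      (hms.comp (by fun_prop : Measurable fun z => (x + √q * z, s))).aestronglyMeasurable
      (ae_of_all _ fun z => ?_)
    have := abs_smooth_sub_le hg hb (x + √q * z) x s s
    simp only [add_sub_cancel_left, sub_self, abs_zero, add_zero, abs_mul,
      abs_of_nonneg (Real.sqrt_nonneg q)] at this
    rw [Real.norm_eq_abs]
    calc _ = |(smooth g (x + √q * z) s - smooth g x s) + smooth g x s| := by ring_nf
      _ ≤ _ := (abs_add_le _ _).trans (add_le_add this le_rfl)
  have i2 : Integrable (fun z : ℝ => √q * z * smoothDeriv g x s) (gaussianReal 0 1) :=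
    (integrable_id_gauss.const_mul _).mul_const _
  have i3 : Integrable (fun z : ℝ => (√q * z) ^ 2 / 2 * smoothDerivTwo g x s)
      (gaussianReal 0 1) := by
    simp only [mul_pow]
    exact ((integrable_sq_gauss.const_mul _).div_const _).mul_const _
  have i4 : Integrable (fun z => smooth g (x + √q * z) s - smooth g x s) (gaussianReal 0 1) :=
    i1.sub (integrable_const _)
  have i5 : Integrable (fun z => smooth g (x + √q * z) s - smooth g x s -
      √q * z * smoothDeriv g x s) (gaussianReal 0 1) := i4.sub i2
  have hid : smooth g x (√(q + s ^ 2)) - smooth g x s - q / 2 * smoothDerivTwo g x s =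
      ∫ z, (smooth g (x + √q * z) s - smooth g x s - √q * z * smoothDeriv g x s
        - (√q * z) ^ 2 / 2 * smoothDerivTwo g x s) ∂(gaussianReal 0 1) := by
    rw [integral_sub i5 i3, integral_sub i4 i2, integral_sub i1 (integrable_const _), hsg]
    simp only [mul_pow, Real.sq_sqrt hq, integral_mul_const, integral_const_mul, integral_div,
      integral_sq_gauss]
    have h0 : ∫ z, √q * z ∂(gaussianReal 0 1) = 0 := by
      rw [integral_const_mul, integral_id_gaussianReal, mul_zero]
    rw [h0]
    simp
  have hbig : Integrable (fun z => 2 * √q ^ (2 + p) * s ^ (-(1 + p)) * |z| ^ (2 + p))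
      (gaussianReal 0 1) := (integrable_abs_rpow_gauss (by linarith)).const_mul _
  rw [hid, ← Real.norm_eq_abs]
  refine (norm_integral_le_of_norm_le hbig (ae_of_all _ fun z => ?_)).trans (le_of_eq ?_)
  · refine (abs_smooth_taylor_le hg hb x (√q * z) hs hp0 hp1).trans (le_of_eq ?_)
    rw [abs_mul, abs_of_nonneg (Real.sqrt_nonneg q), Real.mul_rpow (Real.sqrt_nonneg q)
      (abs_nonneg z)]
    ring
  · rw [integral_const_mul, gaussMoment]
    ring

end Taylor

/-! ### The Wasserstein distance through primitives -/

/-- `1_{0 ≤ y} - 1_{x ≤ y}`, whose integral against `g y` is the primitive of `g` at `x`. -/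
def stepKernel (x y : ℝ) : ℝ :=
  (Set.Ici (0 : ℝ)).indicator 1 y - (Set.Ici x).indicator 1 y

lemma measurable_stepKernel : Measurable fun p : ℝ × ℝ => stepKernel p.1 p.2 := by
  unfold stepKernel
  refine Measurable.sub ((measurable_const.indicator measurableSet_Ici).comp measurable_snd) ?_
  have : (fun p : ℝ × ℝ => (Set.Ici p.1).indicator (1 : ℝ → ℝ) p.2) =
      {p : ℝ × ℝ | p.1 ≤ p.2}.indicator 1 := by
    ext p
    simp [Set.indicator_apply]
  rw [this]
  exact measurable_const.indicator (measurableSet_le measurable_fst measurable_snd)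

lemma stepKernel_of_nonneg {x : ℝ} (hx : 0 ≤ x) :
    stepKernel x = (Set.Ico 0 x).indicator 1 := by
  ext y
  simp only [stepKernel, Set.indicator_apply, Set.mem_Ici, Set.mem_Ico, Pi.one_apply]
  split_ifs <;> first | (exfalso; grind) | simp

lemma stepKernel_of_nonpos {x : ℝ} (hx : x ≤ 0) :
    stepKernel x = fun y => -(Set.Ico x 0).indicator 1 y := by
  ext y
  simp only [stepKernel, Set.indicator_apply, Set.mem_Ici, Set.mem_Ico, Pi.one_apply]
  split_ifs <;> first | (exfalso; grind) | simp

lemma lintegral_enorm_stepKernel (x : ℝ) : ∫⁻ y, ‖stepKernel x y‖ₑ = ‖x‖ₑ := by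
  have h : ∀ a b : ℝ, ∫⁻ y, ‖(Set.Ico a b).indicator (1 : ℝ → ℝ) y‖ₑ = ENNReal.ofReal (b - a) := by
    intro a b
    simp_rw [enorm_indicator_eq_indicator_enorm]
    rw [lintegral_indicator measurableSet_Ico]
    simp
  rcases le_total 0 x with hx | hx
  · rw [stepKernel_of_nonneg hx, h, sub_zero, Real.enorm_eq_ofReal hx]
  · simp_rw [stepKernel_of_nonpos hx, enorm_neg]
    rw [h, zero_sub, ← enorm_neg, Real.enorm_eq_ofReal (neg_nonneg.2 hx)]

lemma primitive_eq_integral_stepKernel (g : ℝ → ℝ) (x : ℝ) :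
    primitive g x = ∫ y, stepKernel x y * g y := by
  have h : ∀ a b : ℝ, ∫ y, (Set.Ico a b).indicator (1 : ℝ → ℝ) y * g y =
      ∫ y in Set.Ioc a b, g y := by
    intro a b
    rw [← integral_Ico_eq_integral_Ioc, ← integral_indicator measurableSet_Ico]
    refine integral_congr_ae (ae_of_all _ fun y => ?_)
    simp [Set.indicator_apply]
  rcases le_total 0 x with hx | hx
  · rw [stepKernel_of_nonneg hx, h, primitive, intervalIntegral.integral_of_le hx]
  · simp only [stepKernel_of_nonpos hx, neg_mul]
    rw [integral_neg, h, primitive, intervalIntegral.integral_of_ge hx]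

lemma integrable_stepKernel_prod {ν : Measure ℝ} [IsProbabilityMeasure ν]
    (hν : Integrable (fun x => x) ν) :
    Integrable (fun p : ℝ × ℝ => stepKernel p.1 p.2) (ν.prod volume) := by
  refine ⟨measurable_stepKernel.aestronglyMeasurable, ?_⟩
  rw [HasFiniteIntegral, lintegral_prod _ measurable_stepKernel.enorm.aemeasurable]
  simp only [lintegral_enorm_stepKernel]
  exact hν.2

lemma integral_stepKernel {ν : Measure ℝ} [IsProbabilityMeasure ν] (y : ℝ) :
    ∫ x, stepKernel x y ∂ν = (Set.Ici (0 : ℝ)).indicator 1 y - cdf ν y := by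
  have h : (fun x => stepKernel x y) =
      fun x => (Set.Ici (0 : ℝ)).indicator 1 y - (Set.Iic y).indicator 1 x := by
    ext x
    simp [stepKernel, Set.indicator_apply]
  have hi : Integrable ((Set.Iic y).indicator (1 : ℝ → ℝ)) ν :=
    (integrable_const (1 : ℝ)).indicator measurableSet_Iic
  rw [h, integral_sub (integrable_const _) hi, integral_indicator_one measurableSet_Iic, cdf_eq_real]
  simp

/-- Integrating the primitive of `g` by parts against two laws with a first moment. -/
lemma integral_primitive_sub {ν κ : Measure ℝ} [IsProbabilityMeasure ν] [IsProbabilityMeasure κ]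
    (hν : Integrable (fun x => x) ν) (hκ : Integrable (fun x => x) κ) {g : ℝ → ℝ}
    (hg : Measurable g) (hb : ∀ x, |g x| ≤ 1) :
    Integrable (fun y => (cdf ν y - cdf κ y) * g y) ∧
      ∫ x, primitive g x ∂κ - ∫ x, primitive g x ∂ν = ∫ y, (cdf ν y - cdf κ y) * g y := by
  have key : ∀ η : Measure ℝ, IsProbabilityMeasure η → Integrable (fun x => x) η →
      Integrable (fun y => ((Set.Ici (0 : ℝ)).indicator 1 y - cdf η y) * g y) ∧
      ∫ x, primitive g x ∂η = ∫ y, ((Set.Ici (0 : ℝ)).indicator 1 y - cdf η y) * g y := by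
    intro η _ hη
    have hi : Integrable (fun p : ℝ × ℝ => stepKernel p.1 p.2 * g p.2) (η.prod volume) :=
      (integrable_stepKernel_prod hη).mul_bdd (hg.comp measurable_snd).aestronglyMeasurable
        (ae_of_all _ fun p => hb p.2)
    have h2 := hi.integral_prod_right
    simp only [integral_mul_const, integral_stepKernel] at h2
    refine ⟨h2, ?_⟩
    simp only [primitive_eq_integral_stepKernel]
    rw [integral_integral_swap hi]
    simp only [integral_mul_const, integral_stepKernel]
  obtain ⟨i1, e1⟩ := key ν inferInstance hν
  obtain ⟨i2, e2⟩ := key κ inferInstance hκ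
  have he : ∀ y, (cdf ν y - cdf κ y) * g y =
      ((Set.Ici (0 : ℝ)).indicator 1 y - cdf κ y) * g y -
        ((Set.Ici (0 : ℝ)).indicator 1 y - cdf ν y) * g y := fun y => by ring
  simp only [he]
  exact ⟨i2.sub i1, by rw [integral_sub i2 i1, e1, e2]⟩

/-- The easy half of Kantorovich duality on the line: the `L¹` distance of the distribution
functions is attained by the primitive of a measurable function with values in `[-1, 1]`. -/
lemma exists_primitive_lintegral_cdf_sub {ν κ : Measure ℝ} [IsProbabilityMeasure ν]
    [IsProbabilityMeasure κ] (hν : Integrable (fun x => x) ν) (hκ : Integrable (fun x => x) κ) :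
    ∃ g : ℝ → ℝ, Measurable g ∧ (∀ x, |g x| ≤ 1) ∧
      ∫⁻ y, ENNReal.ofReal |cdf ν y - cdf κ y| =
        ENNReal.ofReal (∫ x, primitive g x ∂κ - ∫ x, primitive g x ∂ν) := by
  have hm : Measurable fun y => cdf ν y - cdf κ y :=
    (monotone_cdf ν).measurable.sub (monotone_cdf κ).measurable
  refine ⟨fun y => if 0 ≤ cdf ν y - cdf κ y then 1 else -1,
    Measurable.ite (measurableSet_le measurable_const hm) measurable_const measurable_const,
    fun x => by dsimp only; split_ifs <;> simp, ?_⟩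
  obtain ⟨hi, he⟩ := integral_primitive_sub hν hκ
    (g := fun y => if 0 ≤ cdf ν y - cdf κ y then 1 else -1)
    (Measurable.ite (measurableSet_le measurable_const hm) measurable_const measurable_const)
    (fun x => by split_ifs <;> simp)
  have ha : ∀ y, (cdf ν y - cdf κ y) * (if 0 ≤ cdf ν y - cdf κ y then 1 else -1) =
      |cdf ν y - cdf κ y| := fun y => by
    split_ifs with h
    · rw [mul_one, abs_of_nonneg h]
    · rw [mul_neg_one, abs_of_neg (not_le.1 h)]
  simp only [ha] at hi he
  rw [he, ofReal_integral_eq_lintegral_ofReal hi (ae_of_all _ fun _ => abs_nonneg _)]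

/-! ### Sums along the accumulated conditional variance -/

lemma half_le_abs_log {ε : ℝ} (h0 : 0 < ε) (h1 : ε ≤ 1 / 2) : 1 / 2 ≤ |Real.log ε| := by
  have := Real.log_le_sub_one_of_pos h0
  rw [abs_of_nonpos (by linarith)]
  linarith

lemma epsHat_nonneg {ρ ε : ℝ} (h0 : 0 < ε) : 0 ≤ epsHat ρ ε := by
  unfold epsHat
  split_ifs <;> positivity

lemma le_epsHat {ρ ε : ℝ} (h0 : 0 < ε) (h1 : ε ≤ 1 / 2) : ε ≤ 2 * epsHat ρ ε := by
  unfold epsHat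
  split_ifs with h
  · have := Real.rpow_le_rpow_of_exponent_ge h0 (by linarith) h.le
    rw [Real.rpow_one] at this
    linarith
  · nlinarith [half_le_abs_log h0 h1]

/-- Bernoulli's inequality, in the form that compares a step of the Riemann sum of `r^(θ-1)` with a
decrement of the primitive `r^θ / θ`. -/
lemma sub_mul_rpow_le_rpow_sub {a b θ : ℝ} (hb : 0 < b) (hab : b ≤ a) (ha : a ≤ 2 * b)
    (hθ0 : 0 < θ) (hθ1 : θ ≤ 1) : (a - b) * b ^ (θ - 1) ≤ 2 / θ * (a ^ θ - b ^ θ) := by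
  have hapos : 0 < a := hb.trans_le hab
  have h1 : θ * ((a - b) * a ^ (θ - 1)) ≤ a ^ θ - b ^ θ := by
    have h := rpow_one_add_le_one_add_mul_self (s := b / a - 1)
      (by linarith [div_pos hb hapos]) hθ0.le hθ1
    rw [add_sub_cancel, Real.div_rpow hb.le hapos.le, div_le_iff₀ (by positivity)] at h
    rw [Real.rpow_sub_one hapos.ne']
    have : (1 + θ * (b / a - 1)) * a ^ θ = a ^ θ - θ * ((a - b) * (a ^ θ / a)) := by
      field_simp
      ring
    linarith
  have h2 : b ^ (θ - 1) ≤ 2 * a ^ (θ - 1) := by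
    have h3 : (2 * b) ^ (θ - 1) ≤ a ^ (θ - 1) :=
      Real.rpow_le_rpow_of_nonpos hapos ha (by linarith)
    rw [Real.mul_rpow (by norm_num) hb.le] at h3
    have h4 : (2 : ℝ)⁻¹ ≤ 2 ^ (θ - 1) := by
      rw [← Real.rpow_neg_one]
      exact Real.rpow_le_rpow_of_exponent_le (by norm_num) (by linarith)
    nlinarith [Real.rpow_pos_of_pos hb (θ - 1)]
  calc (a - b) * b ^ (θ - 1) ≤ (a - b) * (2 * a ^ (θ - 1)) := by gcongr
    _ = 2 / θ * (θ * ((a - b) * a ^ (θ - 1))) := by field_simp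
    _ ≤ _ := by gcongr

lemma sub_mul_inv_le_log_sub {a b : ℝ} (hb : 0 < b) (hab : b ≤ a) (ha : a ≤ 2 * b) :
    (a - b) * b⁻¹ ≤ 2 * (Real.log a - Real.log b) := by
  have hapos : 0 < a := hb.trans_le hab
  have h := Real.one_sub_inv_le_log_of_pos (div_pos hapos hb)
  rw [Real.log_div hapos.ne' hb.ne', inv_div] at h
  have : (a - b) * b⁻¹ ≤ 2 * (1 - b / a) := by
    rw [← div_eq_mul_inv, div_le_iff₀ hb]
    have e : 2 * (1 - b / a) * b = (a - b) * (2 * b / a) := by field_simp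
    rw [e]
    refine le_mul_of_one_le_right (by linarith) ?_
    rwa [one_le_div hapos]
  linarith

/-- A sum dominated term by term by the decrements of a potential `Ψ` telescopes. -/
lemma sum_Icc_le_of_le_sub {w Ψ : ℕ → ℝ} (h : ∀ k, w (k + 1) ≤ Ψ k - Ψ (k + 1)) (n : ℕ) :
    ∑ k ∈ Finset.Icc 1 n, w k ≤ Ψ 0 - Ψ n := by
  induction n with
  | zero => simp
  | succ n ih =>
    rw [Finset.sum_Icc_succ_top (by omega)]
    linarith [h n]

/-- The Riemann sum comparison behind `epsHat`: along a decreasing sequence `r` from `1 + ε²` to at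
least `ε²` with steps of size at most `ε²`, the sum of `Δr · r^(-(1+p)/2)` is comparable to
`∫ r^(-(1+p)/2) dr` over `[ε², 1 + ε²]`, which is bounded for `p < 1` and logarithmic for `p = 1`. -/
lemma exists_sum_weight_le {ρ : ℝ} (hρ : 0 < ρ) : ∃ K : ℝ, 0 ≤ K ∧ ∀ (ε : ℝ), 0 < ε → ε ≤ 1 / 2 →
    ∀ r : ℕ → ℝ, r 0 = 1 + ε ^ 2 → (∀ k, ε ^ 2 ≤ r k) → (∀ k, r (k + 1) ≤ r k) →
      (∀ k, r k - r (k + 1) ≤ ε ^ 2) → ∀ n, ε ^ min ρ 1 *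
        ∑ k ∈ Finset.Icc 1 n, (r (k - 1) - r k) * √(r k) ^ (-(1 + min ρ 1)) ≤
          K * epsHat ρ ε := by
  rcases lt_or_ge ρ 1 with h | h
  · refine ⟨8 / (1 - ρ), by have := sub_pos.2 h; positivity,
      fun ε h0 h1 r r0 rpos rdec rstep n => ?_⟩
    rw [min_eq_left h.le, epsHat, if_pos h, mul_comm]
    refine mul_le_mul_of_nonneg_right ?_ (by positivity)
    set θ := (1 - ρ) / 2 with hθ
    have hθ0 : 0 < θ := by linarith
    have hpos : ∀ k, 0 < r k := fun k => (by positivity : 0 < ε ^ 2).trans_le (rpos k)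
    have hs : ∀ k, √(r k) ^ (-(1 + ρ)) = r k ^ (θ - 1) := fun k => by
      rw [Real.sqrt_eq_rpow, ← Real.rpow_mul (hpos k).le]
      congr 1
      rw [hθ]
      ring
    simp only [hs]
    refine (sum_Icc_le_of_le_sub (Ψ := fun k => 2 / θ * r k ^ θ) (fun k => ?_) n).trans ?_
    · rw [Nat.add_sub_cancel, ← mul_sub]
      exact sub_mul_rpow_le_rpow_sub (hpos _) (rdec k) (by linarith [rstep k, rpos (k + 1)]) hθ0
        (by linarith)
    · have h2 : r 0 ^ θ ≤ 2 := by
        rw [r0]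
        calc (1 + ε ^ 2) ^ θ ≤ (1 + ε ^ 2) ^ (1 : ℝ) :=
              Real.rpow_le_rpow_of_exponent_le (by nlinarith) (by linarith)
          _ ≤ 2 := by
              rw [Real.rpow_one]
              nlinarith
      have h3 : 0 ≤ 2 / θ * r n ^ θ := by
        have := hpos n
        positivity
      calc 2 / θ * r 0 ^ θ - 2 / θ * r n ^ θ ≤ 2 / θ * 2 - 0 := by gcongr
        _ = 8 / (1 - ρ) := by
          rw [hθ]
          have : 1 - ρ ≠ 0 := by linarith
          field_simp
          ring
  · refine ⟨6, by norm_num, fun ε h0 h1 r r0 rpos rdec rstep n => ?_⟩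
    rw [min_eq_right h, epsHat, if_neg (not_lt.2 h), Real.rpow_one, mul_left_comm]
    refine mul_le_mul_of_nonneg_left ?_ h0.le
    have hpos : ∀ k, 0 < r k := fun k => (by positivity : 0 < ε ^ 2).trans_le (rpos k)
    have hs : ∀ k, √(r k) ^ (-(1 + 1 : ℝ)) = (r k)⁻¹ := fun k => by
      rw [Real.rpow_neg (Real.sqrt_nonneg _), one_add_one_eq_two, Real.rpow_two,
        Real.sq_sqrt (hpos k).le]
    simp only [hs]
    refine (sum_Icc_le_of_le_sub (Ψ := fun k => 2 * Real.log (r k)) (fun k => ?_) n).trans ?_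
    · rw [Nat.add_sub_cancel, ← mul_sub]
      exact sub_mul_inv_le_log_sub (hpos _) (rdec k) (by linarith [rstep k, rpos (k + 1)])
    · have h2 : Real.log (r 0) ≤ ε ^ 2 := by
        rw [r0]
        have := Real.log_le_sub_one_of_pos (x := 1 + ε ^ 2) (by positivity)
        linarith
      have h3 : 2 * Real.log ε ≤ Real.log (r n) := by
        have := Real.log_le_log (by positivity) (rpos n)
        rw [Real.log_pow] at this
        exact_mod_cast this
      have h4 := half_le_abs_log h0 h1
      have h5 : -Real.log ε ≤ |Real.log ε| := neg_le_abs _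
      nlinarith

section Truncation

/-- The accumulated conditional variance `V_k = q_1 + ⋯ + q_k`. -/
def cumVar (q : ℕ → ℝ) (k : ℕ) : ℝ := ∑ i ∈ Finset.Icc 1 k, q i

/-- The indicator of `V_k ≤ 1`. For nonnegative `q` it switches once from `1` to `0`. -/
def keep (q : ℕ → ℝ) (k : ℕ) : ℝ := if cumVar q k ≤ 1 then 1 else 0

/-- The conditional variance accumulated before `V` exceeds `1`. -/
def keptVar (q : ℕ → ℝ) (k : ℕ) : ℝ := ∑ i ∈ Finset.Icc 1 k, keep q i * q i

variable {q : ℕ → ℝ} {δ : ℝ}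

lemma cumVar_succ (q : ℕ → ℝ) (k : ℕ) : cumVar q (k + 1) = cumVar q k + q (k + 1) :=
  Finset.sum_Icc_succ_top (by omega) _

lemma keptVar_succ (q : ℕ → ℝ) (k : ℕ) :
    keptVar q (k + 1) = keptVar q k + keep q (k + 1) * q (k + 1) :=
  Finset.sum_Icc_succ_top (by omega) _

lemma keep_nonneg (q : ℕ → ℝ) (k : ℕ) : 0 ≤ keep q k := by unfold keep; split_ifs <;> simp

lemma keep_le_one (q : ℕ → ℝ) (k : ℕ) : keep q k ≤ 1 := by unfold keep; split_ifs <;> simp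

lemma keep_eq_zero_or_one (q : ℕ → ℝ) (k : ℕ) : keep q k = 0 ∨ keep q k = 1 := by
  unfold keep; split_ifs <;> simp

lemma keptVar_cases (h0 : ∀ i, 0 ≤ q i) (h1 : ∀ i, q i ≤ δ) (k : ℕ) :
    (cumVar q k ≤ 1 ∧ keptVar q k = cumVar q k) ∨
      (1 < cumVar q k ∧ 1 - δ ≤ keptVar q k ∧ keptVar q k ≤ 1) := by
  induction k with
  | zero => left; simp [cumVar, keptVar]
  | succ k ih =>
    have hk0 := h0 (k + 1)
    have hk1 := h1 (k + 1)
    rw [keptVar_succ, keep]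
    rcases le_or_gt (cumVar q (k + 1)) 1 with h | h
    · rw [if_pos h]
      rw [cumVar_succ] at h ⊢
      rcases ih with ih | ih
      · exact .inl ⟨h, by linarith⟩
      · linarith
    · rw [if_neg (not_le.2 h)]
      refine .inr ⟨h, ?_⟩
      rw [cumVar_succ] at h
      rcases ih with ih | ih
      · constructor <;> linarith
      · constructor <;> linarith

lemma keptVar_le_one (h0 : ∀ i, 0 ≤ q i) (h1 : ∀ i, q i ≤ δ) (k : ℕ) : keptVar q k ≤ 1 := by
  rcases keptVar_cases h0 h1 k with h | h
  · exact h.2.le.trans h.1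
  · exact h.2.2

lemma one_sub_keptVar_le (h0 : ∀ i, 0 ≤ q i) (h1 : ∀ i, q i ≤ δ) (k : ℕ) :
    1 - keptVar q k ≤ |cumVar q k - 1| + δ := by
  have hδ : 0 ≤ δ := (h0 0).trans (h1 0)
  rcases keptVar_cases h0 h1 k with h | h
  · linarith [neg_abs_le (cumVar q k - 1)]
  · linarith [abs_nonneg (cumVar q k - 1)]

lemma cumVar_sub_keptVar_le (h0 : ∀ i, 0 ≤ q i) (h1 : ∀ i, q i ≤ δ) (k : ℕ) :
    cumVar q k - keptVar q k ≤ |cumVar q k - 1| + δ := by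
  have hδ : 0 ≤ δ := (h0 0).trans (h1 0)
  rcases keptVar_cases h0 h1 k with h | h
  · linarith [abs_nonneg (cumVar q k - 1)]
  · linarith [le_abs_self (cumVar q k - 1)]

end Truncation

/-! ### Conditional moments -/

lemma rpow_interpolation {x ε ρ p : ℝ} (hx : 0 ≤ x) (hε : 0 < ε) (hρ : 0 < ρ) (hp0 : 0 ≤ p)
    (hp : p ≤ ρ) :
    x ^ (2 + p) ≤ ε ^ p * ((1 - p / ρ) * x ^ 2 + p / ρ * (ε ^ (-ρ) * x ^ (2 + ρ))) := by
  have hy : 0 ≤ x / ε := by positivity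
  have h := Real.geom_mean_le_arith_mean2_weighted (w₁ := 1 - p / ρ) (w₂ := p / ρ) (p₁ := 1)
    (p₂ := (x / ε) ^ ρ) (sub_nonneg.2 ((div_le_one hρ).2 hp)) (by positivity) zero_le_one
    (by positivity) (by ring)
  rw [Real.one_rpow, one_mul, ← Real.rpow_mul hy, mul_div_cancel₀ _ hρ.ne', mul_one,
    Real.div_rpow hx hε.le, Real.div_rpow hx hε.le, div_le_iff₀ (by positivity)] at h
  rw [Real.rpow_add_of_nonneg hx (by norm_num) hp0, Real.rpow_add_of_nonneg hx (by norm_num) hρ.le,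
    Real.rpow_two, Real.rpow_neg hε.le]
  calc x ^ 2 * x ^ p ≤ x ^ 2 * ((1 - p / ρ + p / ρ * (x ^ ρ / ε ^ ρ)) * ε ^ p) := by gcongr
    _ = _ := by ring

lemma sq_le_weighted {x ε ρ : ℝ} (hx : 0 ≤ x) (hε : 0 < ε) (hρ : 0 < ρ) :
    x ^ 2 ≤ ρ / (2 + ρ) * ε ^ 2 + 2 / (2 + ρ) * (ε ^ (-ρ) * x ^ (2 + ρ)) := by
  have hy : 0 ≤ x / ε := by positivity
  have h2 : (0 : ℝ) < 2 + ρ := by linarith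
  have h := Real.geom_mean_le_arith_mean2_weighted (w₁ := ρ / (2 + ρ)) (w₂ := 2 / (2 + ρ))
    (p₁ := 1) (p₂ := (x / ε) ^ (2 + ρ)) (by positivity) (by positivity) zero_le_one
    (by positivity) (by field_simp; ring)
  rw [Real.one_rpow, one_mul, ← Real.rpow_mul hy, mul_div_cancel₀ _ h2.ne', mul_one,
    Real.div_rpow hx hε.le, Real.div_rpow hx hε.le, Real.rpow_two, Real.rpow_two,
    div_le_iff₀ (by positivity)] at h
  refine h.trans (le_of_eq ?_)
  rw [Real.rpow_add hε, Real.rpow_two, Real.rpow_neg hε.le]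
  field_simp

section CondExp

variable {Ω : Type*} {m' m : MeasurableSpace Ω} {μ : Measure Ω}

lemma condExp_abs_rpow_interpolation {X : Ω → ℝ} (hX : MemLp X 2 μ) {ρ p ε : ℝ}
    (hρ : 0 < ρ) (hε : 0 < ε) (hp0 : 0 ≤ p) (hp : p ≤ ρ)
    (hi : Integrable (fun ω => |X ω| ^ (2 + ρ)) μ)
    (h : ∀ᵐ ω ∂μ, (μ[fun ω => |X ω| ^ (2 + ρ) | m']) ω ≤ ε ^ ρ * (μ[fun ω => X ω ^ 2 | m']) ω) :
    Integrable (fun ω => |X ω| ^ (2 + p)) μ ∧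
      ∀ᵐ ω ∂μ, (μ[fun ω => |X ω| ^ (2 + p) | m']) ω ≤ ε ^ p * (μ[fun ω => X ω ^ 2 | m']) ω := by
  have hXm := hX.1
  set a := ε ^ p * (1 - p / ρ)
  set b := ε ^ p * (p / ρ) * ε ^ (-ρ) with hb
  have hpt : ∀ ω, |X ω| ^ (2 + p) ≤ a * X ω ^ 2 + b * |X ω| ^ (2 + ρ) := fun ω => by
    refine (rpow_interpolation (abs_nonneg (X ω)) hε hρ hp0 hp).trans (le_of_eq ?_)
    rw [sq_abs]
    ring
  have hmeas : AEStronglyMeasurable (fun ω => |X ω| ^ (2 + p)) μ :=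
    ((hXm.aemeasurable.abs).pow_const _).aestronglyMeasurable
  have hint : Integrable (fun ω => |X ω| ^ (2 + p)) μ :=
    Integrable.mono' ((hX.integrable_sq.const_mul a).add (hi.const_mul b)) hmeas
      (ae_of_all _ fun ω => by
        rw [Real.norm_of_nonneg (Real.rpow_nonneg (abs_nonneg _) _)]
        exact hpt ω)
  refine ⟨hint, ?_⟩
  have hmono : μ[fun ω => |X ω| ^ (2 + p) | m'] ≤ᵐ[μ]
      μ[(a • fun ω => X ω ^ 2) + b • fun ω => |X ω| ^ (2 + ρ) | m'] :=
    condExp_mono hint ((hX.integrable_sq.smul a).add (hi.smul b)) (ae_of_all _ hpt)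
  have hadd := condExp_add (m := m') (hX.integrable_sq.smul a) (hi.smul b)
  have hs1 := condExp_smul (μ := μ) a (fun ω => X ω ^ 2) m'
  have hs2 := condExp_smul (μ := μ) b (fun ω => |X ω| ^ (2 + ρ)) m'
  filter_upwards [hmono, hadd, hs1, hs2, h] with ω h1 h3 h4 h5 h6
  rw [h3, Pi.add_apply, h4, h5, Pi.smul_apply, Pi.smul_apply, smul_eq_mul, smul_eq_mul] at h1
  refine h1.trans ?_
  calc _ ≤ a * (μ[fun ω => X ω ^ 2 | m']) ω + b * (ε ^ ρ * (μ[fun ω => X ω ^ 2 | m']) ω) := by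
        gcongr
    _ = (a + ε ^ p * (p / ρ) * (ε ^ (-ρ) * ε ^ ρ)) * (μ[fun ω => X ω ^ 2 | m']) ω := by
        rw [hb]
        ring
    _ = _ := by
        rw [← Real.rpow_add hε, neg_add_cancel, Real.rpow_zero]
        ring

lemma integrable_bdd_mul (hm : m' ≤ m) {W Z : Ω → ℝ} {c : ℝ} (hW : Measurable[m'] W)
    (hc : ∀ ω, |W ω| ≤ c) (hZ : Integrable Z μ) : Integrable (fun ω => W ω * Z ω) μ :=
  hZ.bdd_mul (hW.mono hm le_rfl).aestronglyMeasurable (ae_of_all _ hc)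

variable [IsProbabilityMeasure μ]

/-- The conditional moment bound between `ℝ≥0∞`-valued conditional expectations gives
integrability, and the same bound between real conditional expectations. -/
lemma condExp_abs_rpow_le (hm : m' ≤ m) {X : Ω → ℝ} (hX : MemLp X 2 μ) {ρ ε : ℝ}
    (hρ : 0 < ρ) (hε : 0 < ε)
    (h : ∀ᵐ ω ∂μ, (condLExp m' μ (fun ω' => ‖X ω'‖ₑ ^ (2 + ρ))) ω ≤
      ENNReal.ofReal (ε ^ ρ) * (condLExp m' μ (fun ω' => ‖X ω'‖ₑ ^ 2)) ω) :
    Integrable (fun ω => |X ω| ^ (2 + ρ)) μ ∧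
      ∀ᵐ ω ∂μ, (μ[fun ω => |X ω| ^ (2 + ρ) | m']) ω ≤ ε ^ ρ * (μ[fun ω => X ω ^ 2 | m']) ω := by
  have hXm := hX.1
  have e1 : ∀ ω, ‖X ω‖ₑ ^ (2 + ρ) = ENNReal.ofReal (|X ω| ^ (2 + ρ)) := fun ω => by
    rw [Real.enorm_eq_ofReal_abs, ENNReal.ofReal_rpow_of_nonneg (abs_nonneg _) (by linarith)]
  have e2 : ∀ ω, ‖X ω‖ₑ ^ 2 = ENNReal.ofReal (X ω ^ 2) := fun ω => by
    rw [Real.enorm_eq_ofReal_abs, ← ENNReal.ofReal_pow (abs_nonneg _), sq_abs]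
  have hfin2 : ∫⁻ ω, ‖X ω‖ₑ ^ 2 ∂μ ≠ ∞ := by
    simp only [e2]
    rw [← ofReal_integral_eq_lintegral_ofReal hX.integrable_sq (ae_of_all _ fun _ => sq_nonneg _)]
    exact ENNReal.ofReal_ne_top
  have hfin : ∫⁻ ω, ‖X ω‖ₑ ^ (2 + ρ) ∂μ ≠ ∞ := by
    rw [← lintegral_condLExp hm μ]
    refine ne_top_of_le_ne_top ?_ (lintegral_mono_ae h)
    rw [lintegral_const_mul' _ _ ENNReal.ofReal_ne_top, lintegral_condLExp hm μ]
    exact ENNReal.mul_ne_top ENNReal.ofReal_ne_top hfin2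
  have hmeas : AEStronglyMeasurable (fun ω => |X ω| ^ (2 + ρ)) μ :=
    ((hXm.aemeasurable.abs).pow_const _).aestronglyMeasurable
  have t1 := toReal_condLExp m' (hXm.enorm.pow_const (2 + ρ)) hfin
  have t2 := toReal_condLExp m' (hXm.enorm.pow_const 2) hfin2
  simp only [e1, ENNReal.toReal_ofReal (Real.rpow_nonneg (abs_nonneg _) _)] at t1
  simp only [e2, ENNReal.toReal_ofReal (sq_nonneg _)] at t2
  simp only [e1] at h hfin
  simp only [e2] at h hfin2
  refine ⟨⟨hmeas, ?_⟩, ?_⟩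
  · rw [hasFiniteIntegral_iff_ofReal (ae_of_all _ fun _ => Real.rpow_nonneg (abs_nonneg _) _)]
    exact hfin.lt_top
  · filter_upwards [h, t1, t2, condLExp_ne_top (mΩ := m') hfin2] with ω h h1 h2 h3
    rw [← h1, ← h2, ← ENNReal.toReal_ofReal (Real.rpow_nonneg hε.le ρ), ← ENNReal.toReal_mul]
    exact ENNReal.toReal_mono (ENNReal.mul_ne_top ENNReal.ofReal_ne_top h3) h

lemma condExp_sq_le {X : Ω → ℝ} (hm : m' ≤ m) (hX : MemLp X 2 μ) {ρ ε : ℝ}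
    (hρ : 0 < ρ) (hε : 0 < ε) (hi : Integrable (fun ω => |X ω| ^ (2 + ρ)) μ)
    (h : ∀ᵐ ω ∂μ, (μ[fun ω => |X ω| ^ (2 + ρ) | m']) ω ≤ ε ^ ρ * (μ[fun ω => X ω ^ 2 | m']) ω) :
    ∀ᵐ ω ∂μ, (μ[fun ω => X ω ^ 2 | m']) ω ≤ ε ^ 2 := by
  have h2 : (0 : ℝ) < 2 + ρ := by linarith
  have hmono : μ[fun ω => X ω ^ 2 | m'] ≤ᵐ[μ]
      μ[(fun _ => ρ / (2 + ρ) * ε ^ 2) + (2 / (2 + ρ) * ε ^ (-ρ)) • fun ω => |X ω| ^ (2 + ρ) | m'] :=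
    condExp_mono hX.integrable_sq ((integrable_const _).add (hi.smul _)) (ae_of_all _ fun ω => by
      have := sq_le_weighted (abs_nonneg (X ω)) hε hρ
      rw [sq_abs] at this
      simpa [mul_assoc] using this)
  have hadd := condExp_add (m := m') (integrable_const (μ := μ) (ρ / (2 + ρ) * ε ^ 2))
    (hi.smul (2 / (2 + ρ) * ε ^ (-ρ)))
  have hsmul := condExp_smul (μ := μ) (2 / (2 + ρ) * ε ^ (-ρ)) (fun ω => |X ω| ^ (2 + ρ)) m'
  filter_upwards [hmono, hadd, hsmul, h] with ω h1 h3 h4 h5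
  rw [h3, Pi.add_apply, h4, condExp_const hm, Pi.smul_apply, smul_eq_mul] at h1
  have h6 : 2 / (2 + ρ) * ε ^ (-ρ) * (μ[fun ω => |X ω| ^ (2 + ρ) | m']) ω ≤
      2 / (2 + ρ) * (μ[fun ω => X ω ^ 2 | m']) ω := by
    calc _ ≤ 2 / (2 + ρ) * ε ^ (-ρ) * (ε ^ ρ * (μ[fun ω => X ω ^ 2 | m']) ω) := by gcongr
      _ = 2 / (2 + ρ) * (ε ^ (-ρ) * ε ^ ρ) * (μ[fun ω => X ω ^ 2 | m']) ω := by ring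
      _ = _ := by rw [← Real.rpow_add hε, neg_add_cancel, Real.rpow_zero, mul_one]
  have h7 : ρ / (2 + ρ) * (μ[fun ω => X ω ^ 2 | m']) ω ≤ ρ / (2 + ρ) * ε ^ 2 := by
    have h8 : ρ / (2 + ρ) * (μ[fun ω => X ω ^ 2 | m']) ω =
        (μ[fun ω => X ω ^ 2 | m']) ω - 2 / (2 + ρ) * (μ[fun ω => X ω ^ 2 | m']) ω := by
      field_simp
      ring
    rw [h8]
    dsimp only at h1
    linarith
  exact le_of_mul_le_mul_left h7 (by positivity)

lemma integral_mul_condExp (hm : m' ≤ m) {W Z : Ω → ℝ} (hW : Measurable[m'] W)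
    (hWZ : Integrable (fun ω => W ω * Z ω) μ) (hZ : Integrable Z μ) :
    ∫ ω, W ω * Z ω ∂μ = ∫ ω, W ω * (μ[Z | m']) ω ∂μ := by
  rw [← integral_condExp hm]
  exact integral_congr_ae (condExp_mul_of_stronglyMeasurable_left hW.stronglyMeasurable hWZ hZ)

lemma integral_abs_le_sqrt {Y : Ω → ℝ} (hY : MemLp Y 2 μ) :
    ∫ ω, |Y ω| ∂μ ≤ √(∫ ω, Y ω ^ 2 ∂μ) := by
  have h := variance_nonneg |Y| μ
  rw [variance_eq_sub hY.abs] at h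
  have e : (|Y| ^ 2 : Ω → ℝ) = fun ω => Y ω ^ 2 := by
    ext ω
    simp
  rw [e] at h
  refine Real.le_sqrt_of_sq_le ?_
  simpa using h

end CondExp

/-! ### One step of Lindeberg's method -/

section Lindeberg

variable {Ω : Type*} {m' m : MeasurableSpace Ω} {μ : Measure Ω} [IsProbabilityMeasure μ]

/-- One replacement step of Lindeberg's method: given the past `m'`, the increment `χ η` with
conditional variance `χ q` is exchanged for an increase by `χ q` of the variance of the smoothing.
The first and second order terms cancel in mean, because the coefficients of the Taylor expansion
are measurable with respect to the past. -/
lemma abs_integral_smooth_step_le (hm : m' ≤ m) {g : ℝ → ℝ} (hg : Measurable g)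
    (hb : ∀ x, |g x| ≤ 1) {p ε : ℝ} (hp0 : 0 ≤ p) (hp1 : p ≤ 1) (hε : 0 < ε)
    {x s χ q η : Ω → ℝ} (hx : Measurable[m'] x) (hs : Measurable[m'] s) (hχ : Measurable[m'] χ)
    (hq : Measurable[m'] q) (hη : MemLp η 2 μ) (hsε : ∀ ω, ε ≤ s ω)
    (hχ01 : ∀ ω, χ ω = 0 ∨ χ ω = 1) (hq0 : ∀ ω, 0 ≤ q ω) (hqε : ∀ ω, q ω ≤ ε ^ 2)
    (hmean : μ[η | m'] =ᵐ[μ] 0) (hvar : μ[fun ω => η ω ^ 2 | m'] =ᵐ[μ] q)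
    (hint : Integrable (fun ω => |η ω| ^ (2 + p)) μ)
    (hmom : ∀ᵐ ω ∂μ, (μ[fun ω => |η ω| ^ (2 + p) | m']) ω ≤ ε ^ p * q ω) :
    |∫ ω, (smooth g (x ω + χ ω * η ω) (s ω) - smooth g (x ω) (√(χ ω * q ω + s ω ^ 2))) ∂μ| ≤
      (2 + 2 * gaussMoment p) * ε ^ p * ∫ ω, χ ω * q ω * s ω ^ (-(1 + p)) ∂μ := by
  have hspos : ∀ ω, 0 < s ω := fun ω => hε.trans_le (hsε ω)
  have hχ0 : ∀ ω, 0 ≤ χ ω := fun ω => by rcases hχ01 ω with h | h <;> simp [h]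
  have hχ1 : ∀ ω, |χ ω| ≤ 1 := fun ω => by rcases hχ01 ω with h | h <;> simp [h]
  have hM := gaussMoment_nonneg p
  have hηi : Integrable η μ := hη.integrable (by norm_num)
  have hq' : Measurable q := hq.mono hm le_rfl
  have hqi : Integrable q μ :=
    Integrable.mono' (integrable_const (ε ^ 2)) hq'.aestronglyMeasurable (ae_of_all _ fun ω => by
      rw [Real.norm_of_nonneg (hq0 ω)]
      exact hqε ω)
  set W1 : Ω → ℝ := fun ω => χ ω * smoothDeriv g (x ω) (s ω) with hW1
  set W2 : Ω → ℝ := fun ω => χ ω * smoothDerivTwo g (x ω) (s ω) with hW2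
  set w : Ω → ℝ := fun ω => χ ω * s ω ^ (-(1 + p)) with hw
  have hW1m : Measurable[m'] W1 := hχ.mul ((measurable_smoothDeriv hg).comp (hx.prodMk hs))
  have hW2m : Measurable[m'] W2 := hχ.mul ((measurable_smoothDerivTwo hg).comp (hx.prodMk hs))
  have hwm : Measurable[m'] w := hχ.mul (hs.pow_const _)
  have hw0 : ∀ ω, 0 ≤ w ω := fun ω => mul_nonneg (hχ0 ω) (Real.rpow_nonneg (hspos ω).le _)
  have hW1b : ∀ ω, |W1 ω| ≤ 1 := fun ω => by
    rw [hW1, abs_mul]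
    exact mul_le_one₀ (hχ1 ω) (abs_nonneg _) (abs_smoothDeriv_le hb _ _)
  have hW2b : ∀ ω, |W2 ω| ≤ ε⁻¹ := fun ω => by
    rw [hW2, abs_mul]
    refine (mul_le_of_le_one_left (abs_nonneg _) (hχ1 ω)).trans ?_
    exact (abs_smoothDerivTwo_le hb _ (hspos ω)).trans (inv_anti₀ hε (hsε ω))
  have hwb : ∀ ω, |w ω| ≤ ε ^ (-(1 + p)) := fun ω => by
    rw [hw, abs_mul, abs_of_nonneg (Real.rpow_nonneg (hspos ω).le _)]
    refine (mul_le_of_le_one_left (Real.rpow_nonneg (hspos ω).le _) (hχ1 ω)).trans ?_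
    exact Real.rpow_le_rpow_of_nonpos hε (hsε ω) (by linarith)
  have i1 := integrable_bdd_mul hm hW1m hW1b hηi
  have i2 := integrable_bdd_mul hm hW2m hW2b hη.integrable_sq
  have i2' := integrable_bdd_mul hm hW2m hW2b hqi
  have i3 := integrable_bdd_mul hm hwm hwb hint
  have i3' := integrable_bdd_mul hm hwm hwb hqi
  have e1 : ∫ ω, W1 ω * η ω ∂μ = 0 := by
    rw [integral_mul_condExp hm hW1m i1 hηi]
    refine integral_eq_zero_of_ae ?_
    filter_upwards [hmean] with ω h
    simp [h]
  have e2 : ∫ ω, W2 ω * η ω ^ 2 ∂μ = ∫ ω, W2 ω * q ω ∂μ := by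
    rw [integral_mul_condExp hm hW2m i2 hη.integrable_sq]
    refine integral_congr_ae ?_
    filter_upwards [hvar] with ω h
    rw [h]
  have e3 : ∫ ω, w ω * |η ω| ^ (2 + p) ∂μ ≤ ε ^ p * ∫ ω, w ω * q ω ∂μ := by
    rw [integral_mul_condExp hm hwm i3 hint, ← integral_const_mul]
    refine integral_mono_ae (integrable_bdd_mul hm hwm hwb integrable_condExp)
      (i3'.const_mul _) ?_
    filter_upwards [hmom] with ω h
    calc _ ≤ w ω * (ε ^ p * q ω) := mul_le_mul_of_nonneg_left h (hw0 ω)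
      _ = _ := by ring
  have i4 : Integrable (fun ω => W2 ω * η ω ^ 2 - W2 ω * q ω) μ := i2.sub i2'
  have i5 : Integrable (fun ω => (W2 ω * η ω ^ 2 - W2 ω * q ω) / 2) μ := i4.div_const 2
  have i6 : Integrable (fun ω => W1 ω * η ω + (W2 ω * η ω ^ 2 - W2 ω * q ω) / 2) μ := i1.add i5
  have e4 : ∫ ω, (W1 ω * η ω + (W2 ω * η ω ^ 2 - W2 ω * q ω) / 2) ∂μ = 0 := by
    rw [integral_add i1 i5, integral_div, integral_sub i2 i2', e1, e2]
    simp
  have i7 : Integrable (fun ω => 2 * (w ω * |η ω| ^ (2 + p))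
      + 2 * gaussMoment p * ε ^ p * (w ω * q ω)) μ := (i3.const_mul _).add (i3'.const_mul _)
  -- The pointwise Taylor estimate, in which `χ` may be factored out because it is an indicator.
  have hpt : ∀ ω, |smooth g (x ω + χ ω * η ω) (s ω) - smooth g (x ω) (√(χ ω * q ω + s ω ^ 2))
      - (W1 ω * η ω + (W2 ω * η ω ^ 2 - W2 ω * q ω) / 2)| ≤
      2 * (w ω * |η ω| ^ (2 + p)) + 2 * gaussMoment p * ε ^ p * (w ω * q ω) := by
    intro ω
    rcases hχ01 ω with h | h
    · simp [hW1, hW2, hw, h, Real.sqrt_sq (hspos ω).le]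
    · have t1 := abs_smooth_taylor_le hg hb (x ω) (η ω) (hspos ω) hp0 hp1
      have t2 := abs_smooth_sqrt_add_le hg hb (x ω) (hq0 ω) (hspos ω) hp0 hp1
      have t3 : √(q ω) ^ (2 + p) ≤ q ω * ε ^ p := by
        rw [Real.rpow_add_of_nonneg (Real.sqrt_nonneg _) (by norm_num) hp0, Real.rpow_two,
          Real.sq_sqrt (hq0 ω)]
        refine mul_le_mul_of_nonneg_left ?_ (hq0 ω)
        refine Real.rpow_le_rpow (Real.sqrt_nonneg _) ?_ hp0
        exact Real.sqrt_le_iff.2 ⟨hε.le, hqε ω⟩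
      have t4 : 2 * gaussMoment p * √(q ω) ^ (2 + p) * s ω ^ (-(1 + p)) ≤
          2 * gaussMoment p * (q ω * ε ^ p) * s ω ^ (-(1 + p)) := by
        gcongr
        exact Real.rpow_nonneg (hspos ω).le _
      simp only [hW1, hW2, hw, h, one_mul]
      have t5 := (abs_sub _ _).trans (add_le_add t1 (t2.trans t4))
      refine le_trans (le_of_eq (congrArg _ ?_)) (t5.trans (le_of_eq ?_))
      · ring
      · ring
  have hmeas : AEStronglyMeasurable (fun ω => smooth g (x ω + χ ω * η ω) (s ω)
      - smooth g (x ω) (√(χ ω * q ω + s ω ^ 2))) μ := by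
    have hms := measurable_smooth hg hb
    have hx' := hx.mono hm le_rfl
    have hs' := hs.mono hm le_rfl
    have hχ' := hχ.mono hm le_rfl
    have hη' := hη.1.aemeasurable
    refine AEMeasurable.aestronglyMeasurable (AEMeasurable.sub ?_ ?_)
    · exact hms.comp_aemeasurable
        ((hx'.aemeasurable.add (hχ'.aemeasurable.mul hη')).prodMk hs'.aemeasurable)
    · exact (hms.comp (hx'.prodMk
        (((hχ'.mul hq').add (hs'.pow_const 2)).sqrt))).aemeasurable
  have i8 : Integrable (fun ω => smooth g (x ω + χ ω * η ω) (s ω)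
      - smooth g (x ω) (√(χ ω * q ω + s ω ^ 2))
      - (W1 ω * η ω + (W2 ω * η ω ^ 2 - W2 ω * q ω) / 2)) μ :=
    Integrable.mono' i7 (hmeas.sub i6.1) (ae_of_all _ hpt)
  have e5 : ∫ ω, (smooth g (x ω + χ ω * η ω) (s ω) - smooth g (x ω) (√(χ ω * q ω + s ω ^ 2))) ∂μ =
      ∫ ω, (smooth g (x ω + χ ω * η ω) (s ω) - smooth g (x ω) (√(χ ω * q ω + s ω ^ 2))
        - (W1 ω * η ω + (W2 ω * η ω ^ 2 - W2 ω * q ω) / 2)) ∂μ := by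
    have := integral_add i8 i6
    rw [e4, add_zero] at this
    rw [← this]
    simp only [sub_add_cancel]
  rw [e5, ← Real.norm_eq_abs]
  refine (norm_integral_le_of_norm_le i7 (ae_of_all _ hpt)).trans ?_
  rw [integral_add (i3.const_mul _) (i3'.const_mul _), integral_const_mul, integral_const_mul]
  have e6 : ∫ ω, χ ω * q ω * s ω ^ (-(1 + p)) ∂μ = ∫ ω, w ω * q ω ∂μ :=
    integral_congr_ae (ae_of_all _ fun ω => by simp only [hw]; ring)
  rw [e6]
  linarith

end Lindeberg

/-! ### The stopped martingale -/

section Martingale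

variable {Ω : Type*} {m : MeasurableSpace Ω} {μ : Measure Ω}

/-- Martingale differences `ξ_{k+1}`, `k : ℕ`, with everywhere bounded versions `q_{k+1} ∈ [0, ε²]`
of their conditional variances, and with conditional moments of order `2 + p` bounded by
`ε^p q_{k+1}`. -/
structure HasBoundedVariances (μ : Measure Ω) (ℱ : Filtration ℕ m) (ξ q : ℕ → Ω → ℝ)
    (p ε : ℝ) : Prop where
  measurable : ∀ k, Measurable[ℱ (k + 1)] (ξ (k + 1))
  memLp : ∀ k, MemLp (ξ (k + 1)) 2 μ
  condExp_eq_zero : ∀ k, μ[ξ (k + 1) | ℱ k] =ᵐ[μ] 0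
  measurable_var : ∀ k, Measurable[ℱ k] (q (k + 1))
  var_nonneg : ∀ k ω, 0 ≤ q k ω
  var_le : ∀ k ω, q k ω ≤ ε ^ 2
  condExp_sq : ∀ k, μ[fun ω => ξ (k + 1) ω ^ 2 | ℱ k] =ᵐ[μ] q (k + 1)
  integrable_rpow : ∀ k, Integrable (fun ω => |ξ (k + 1) ω| ^ (2 + p)) μ
  condExp_rpow : ∀ k, ∀ᵐ ω ∂μ, (μ[fun ω => |ξ (k + 1) ω| ^ (2 + p) | ℱ k]) ω ≤ ε ^ p * q (k + 1) ω

/-- The martingale stopped just before its conditional variance exceeds `1`. -/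
def keptSum (ξ q : ℕ → Ω → ℝ) (k : ℕ) (ω : Ω) : ℝ :=
  ∑ i ∈ Finset.Icc 1 k, keep (fun j => q j ω) i * ξ i ω

/-- The smoothing parameter that remains after `k` replacement steps; it decreases from
`√(1 + ε²)` and stays above `ε`. -/
def remaining (q : ℕ → Ω → ℝ) (ε : ℝ) (k : ℕ) (ω : Ω) : ℝ :=
  √(1 + ε ^ 2 - keptVar (fun j => q j ω) k)

lemma keptSum_succ (ξ q : ℕ → Ω → ℝ) (k : ℕ) (ω : Ω) :
    keptSum ξ q (k + 1) ω = keptSum ξ q k ω + keep (fun j => q j ω) (k + 1) * ξ (k + 1) ω :=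
  Finset.sum_Icc_succ_top (by omega) _

lemma partialSum_succ (ξ : ℕ → Ω → ℝ) (k : ℕ) (ω : Ω) :
    partialSum (k + 1) ξ ω = partialSum k ξ ω + ξ (k + 1) ω :=
  Finset.sum_Icc_succ_top (by omega) _

lemma integrable_smooth {g : ℝ → ℝ} (hg : Measurable g) (hb : ∀ x, |g x| ≤ 1) {X Y : Ω → ℝ}
    (hX : Integrable X μ) (hY : Integrable Y μ) : Integrable (fun ω => smooth g (X ω) (Y ω)) μ := by
  refine Integrable.mono' (hX.abs.add hY.abs)
    ((measurable_smooth hg hb).comp_aemeasurable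
      (hX.1.aemeasurable.prodMk hY.1.aemeasurable)).aestronglyMeasurable (ae_of_all _ fun ω => ?_)
  have := abs_smooth_sub_le hg hb (X ω) 0 (Y ω) 0
  simpa [smooth_zero_right, primitive] using this

namespace HasBoundedVariances

variable {ℱ : Filtration ℕ m} {ξ q : ℕ → Ω → ℝ} {p ε : ℝ}

lemma measurable_cumVar (h : HasBoundedVariances μ ℱ ξ q p ε) (k : ℕ) :
    Measurable[ℱ k] fun ω => cumVar (fun j => q j ω) (k + 1) := by
  unfold cumVar
  refine Finset.measurable_fun_sum _ fun i hi => ?_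
  obtain ⟨h1, h2⟩ := Finset.mem_Icc.1 hi
  obtain ⟨j, rfl⟩ := Nat.exists_eq_add_of_le' h1
  exact (h.measurable_var j).mono (ℱ.mono (by omega)) le_rfl

lemma measurable_keep (h : HasBoundedVariances μ ℱ ξ q p ε) (k : ℕ) :
    Measurable[ℱ k] fun ω => keep (fun j => q j ω) (k + 1) := by
  unfold keep
  exact Measurable.ite (measurableSet_le (h.measurable_cumVar k) measurable_const)
    measurable_const measurable_const

lemma measurable_keptVar (h : HasBoundedVariances μ ℱ ξ q p ε) (k : ℕ) :
    Measurable[ℱ k] fun ω => keptVar (fun j => q j ω) (k + 1) := by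
  unfold keptVar
  refine Finset.measurable_fun_sum _ fun i hi => ?_
  obtain ⟨h1, h2⟩ := Finset.mem_Icc.1 hi
  obtain ⟨j, rfl⟩ := Nat.exists_eq_add_of_le' h1
  exact ((h.measurable_keep j).mul (h.measurable_var j)).mono (ℱ.mono (by omega)) le_rfl

lemma measurable_remaining (h : HasBoundedVariances μ ℱ ξ q p ε) (k : ℕ) :
    Measurable[ℱ k] (remaining q ε (k + 1)) :=
  (measurable_const.sub (h.measurable_keptVar k)).sqrt

lemma measurable_remaining' (h : HasBoundedVariances μ ℱ ξ q p ε) (k : ℕ) :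
    Measurable (remaining q ε k) := by
  cases k with
  | zero =>
    have : remaining q ε 0 = fun _ => √(1 + ε ^ 2) := by ext; simp [remaining, keptVar]
    rw [this]
    exact measurable_const
  | succ k => exact (h.measurable_remaining k).mono (ℱ.le k) le_rfl

lemma measurable_keptSum (h : HasBoundedVariances μ ℱ ξ q p ε) (k : ℕ) :
    Measurable[ℱ k] (keptSum ξ q k) := by
  refine Finset.measurable_fun_sum _ fun i hi => ?_
  obtain ⟨h1, h2⟩ := Finset.mem_Icc.1 hi
  obtain ⟨j, rfl⟩ := Nat.exists_eq_add_of_le' h1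
  exact (((h.measurable_keep j).mono (ℱ.mono (by omega)) le_rfl).mul (h.measurable j)).mono
    (ℱ.mono h2) le_rfl

lemma measurable_partialSum (h : HasBoundedVariances μ ℱ ξ q p ε) (k : ℕ) :
    Measurable[ℱ k] (partialSum k ξ) := by
  refine Finset.measurable_fun_sum _ fun i hi => ?_
  obtain ⟨h1, h2⟩ := Finset.mem_Icc.1 hi
  obtain ⟨j, rfl⟩ := Nat.exists_eq_add_of_le' h1
  exact (h.measurable j).mono (ℱ.mono h2) le_rfl

lemma memLp_keep_mul (h : HasBoundedVariances μ ℱ ξ q p ε) (k : ℕ) :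
    MemLp (fun ω => keep (fun j => q j ω) (k + 1) * ξ (k + 1) ω) 2 μ :=
  (h.memLp k).of_le ((((h.measurable_keep k).mono (ℱ.le _) le_rfl).mul
    ((h.measurable k).mono (ℱ.le _) le_rfl)).aestronglyMeasurable) (ae_of_all _ fun ω => by
      rw [norm_mul, Real.norm_of_nonneg (keep_nonneg _ _)]
      exact mul_le_of_le_one_left (norm_nonneg _) (keep_le_one _ _))

lemma memLp_keptSum (h : HasBoundedVariances μ ℱ ξ q p ε) (k : ℕ) :
    MemLp (keptSum ξ q k) 2 μ := by
  refine memLp_finsetSum _ fun i hi => ?_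
  obtain ⟨j, rfl⟩ := Nat.exists_eq_add_of_le' (Finset.mem_Icc.1 hi).1
  exact h.memLp_keep_mul j

lemma memLp_partialSum (h : HasBoundedVariances μ ℱ ξ q p ε) (k : ℕ) :
    MemLp (partialSum k ξ) 2 μ := by
  refine memLp_finsetSum _ fun i hi => ?_
  obtain ⟨j, rfl⟩ := Nat.exists_eq_add_of_le' (Finset.mem_Icc.1 hi).1
  exact h.memLp j

lemma sq_remaining (h : HasBoundedVariances μ ℱ ξ q p ε) (k : ℕ) (ω : Ω) :
    remaining q ε k ω ^ 2 = 1 + ε ^ 2 - keptVar (fun j => q j ω) k := by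
  refine Real.sq_sqrt ?_
  have := keptVar_le_one (fun i => h.var_nonneg i ω) (fun i => h.var_le i ω) k
  nlinarith

lemma keptVar_nonneg (h : HasBoundedVariances μ ℱ ξ q p ε) (k : ℕ) (ω : Ω) :
    0 ≤ keptVar (fun j => q j ω) k :=
  Finset.sum_nonneg fun i _ => mul_nonneg (keep_nonneg _ _) (h.var_nonneg i ω)

lemma le_remaining (h : HasBoundedVariances μ ℱ ξ q p ε) (k : ℕ) (ω : Ω) :
    ε ≤ remaining q ε k ω := by
  refine Real.le_sqrt_of_sq_le ?_
  have := keptVar_le_one (fun i => h.var_nonneg i ω) (fun i => h.var_le i ω) k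
  linarith

lemma remaining_le (h : HasBoundedVariances μ ℱ ξ q p ε) (k : ℕ) (ω : Ω) :
    remaining q ε k ω ≤ √(1 + ε ^ 2) :=
  Real.sqrt_le_sqrt (by linarith [h.keptVar_nonneg k ω])

lemma remaining_eq_sqrt (h : HasBoundedVariances μ ℱ ξ q p ε) (k : ℕ) (ω : Ω) :
    remaining q ε k ω =
      √(keep (fun j => q j ω) (k + 1) * q (k + 1) ω + remaining q ε (k + 1) ω ^ 2) := by
  rw [h.sq_remaining, remaining, keptVar_succ]
  congr 1
  ring

variable [IsProbabilityMeasure μ]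

lemma memLp_remaining (h : HasBoundedVariances μ ℱ ξ q p ε) (k : ℕ) :
    MemLp (remaining q ε k) 2 μ :=
  MemLp.of_bound (h.measurable_remaining' k).aestronglyMeasurable (√(1 + ε ^ 2))
    (ae_of_all _ fun ω => by
      rw [remaining, Real.norm_of_nonneg (Real.sqrt_nonneg _)]
      exact h.remaining_le k ω)

/-- The summed replacement steps. -/
lemma abs_integral_smooth_sub_le (h : HasBoundedVariances μ ℱ ξ q p ε) {g : ℝ → ℝ}
    (hg : Measurable g) (hb : ∀ x, |g x| ≤ 1) (hp0 : 0 ≤ p) (hp1 : p ≤ 1) (hε : 0 < ε) (n : ℕ) :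
    |∫ ω, smooth g (keptSum ξ q n ω) (remaining q ε n ω) ∂μ - smooth g 0 (√(1 + ε ^ 2))| ≤
      (2 + 2 * gaussMoment p) * ε ^ p * ∑ k ∈ Finset.Icc 1 n,
        ∫ ω, keep (fun j => q j ω) k * q k ω * remaining q ε k ω ^ (-(1 + p)) ∂μ := by
  induction n with
  | zero => simp [keptSum, remaining, keptVar]
  | succ n ih =>
    rw [Finset.sum_Icc_succ_top (by omega), mul_add]
    have hstep := abs_integral_smooth_step_le (μ := μ) (ℱ.le n) hg hb hp0 hp1 hε
      (h.measurable_keptSum n) (h.measurable_remaining n) (h.measurable_keep n)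
      (h.measurable_var n) (h.memLp n) (h.le_remaining (n + 1)) (fun ω => keep_eq_zero_or_one _ _)
      (h.var_nonneg _) (h.var_le _) (h.condExp_eq_zero n) (h.condExp_sq n) (h.integrable_rpow n)
      (h.condExp_rpow n)
    simp only [← h.remaining_eq_sqrt n, ← keptSum_succ] at hstep
    have hi : ∀ k, Integrable (fun ω => smooth g (keptSum ξ q k ω) (remaining q ε k ω)) μ :=
      fun k => integrable_smooth hg hb ((h.memLp_keptSum k).integrable (by norm_num))
        ((h.memLp_remaining k).integrable (by norm_num))
    rw [integral_sub (hi _) (hi _)] at hstep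
    have := (abs_add_le _ _).trans (add_le_add ih hstep)
    rw [sub_add_sub_comm, add_comm (smooth g 0 _), add_sub_add_left_eq_sub] at this
    exact this

lemma integrable_weight (h : HasBoundedVariances μ ℱ ξ q p ε) (hp0 : 0 ≤ p) (hε : 0 < ε) (k : ℕ) :
    Integrable (fun ω => keep (fun j => q j ω) (k + 1) * q (k + 1) ω *
      remaining q ε (k + 1) ω ^ (-(1 + p))) μ := by
  refine Integrable.mono' (integrable_const (1 * ε ^ 2 * ε ^ (-(1 + p))))
    ((((h.measurable_keep k).mul (h.measurable_var k)).mul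
      ((h.measurable_remaining k).pow_const _)).mono (ℱ.le k) le_rfl).aestronglyMeasurable
    (ae_of_all _ fun ω => ?_)
  have h1 := h.le_remaining (k + 1) ω
  have h2 := Real.rpow_nonneg (hε.le.trans h1) (-(1 + p))
  rw [norm_mul, norm_mul, Real.norm_of_nonneg (keep_nonneg _ _),
    Real.norm_of_nonneg (h.var_nonneg _ _), Real.norm_of_nonneg h2]
  have := keep_le_one (fun j => q j ω) (k + 1)
  have h3 := h.var_nonneg (k + 1) ω
  have h4 := h.var_le (k + 1) ω
  have h5 : remaining q ε (k + 1) ω ^ (-(1 + p)) ≤ ε ^ (-(1 + p)) :=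
    Real.rpow_le_rpow_of_nonpos hε h1 (by linarith)
  gcongr

lemma integrable_var (h : HasBoundedVariances μ ℱ ξ q p ε) (k : ℕ) :
    Integrable (q (k + 1)) μ :=
  Integrable.mono' (integrable_const (ε ^ 2))
    ((h.measurable_var k).mono (ℱ.le k) le_rfl).aestronglyMeasurable
    (ae_of_all _ fun ω => by
      rw [Real.norm_of_nonneg (h.var_nonneg _ ω)]
      exact h.var_le _ ω)

lemma integrable_cumVar (h : HasBoundedVariances μ ℱ ξ q p ε) (k : ℕ) :
    Integrable (fun ω => cumVar (fun j => q j ω) k) μ := by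
  refine integrable_finsetSum _ fun i hi => ?_
  obtain ⟨j, rfl⟩ := Nat.exists_eq_add_of_le' (Finset.mem_Icc.1 hi).1
  exact h.integrable_var j

lemma integrable_keptVar (h : HasBoundedVariances μ ℱ ξ q p ε) (k : ℕ) :
    Integrable (fun ω => keptVar (fun j => q j ω) k) μ := by
  refine integrable_finsetSum _ fun i hi => ?_
  obtain ⟨j, rfl⟩ := Nat.exists_eq_add_of_le' (Finset.mem_Icc.1 hi).1
  refine integrable_bdd_mul (c := 1) (ℱ.le j) (h.measurable_keep j) (fun ω => ?_)
    (h.integrable_var j)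
  rw [abs_of_nonneg (keep_nonneg _ _)]
  exact keep_le_one _ _

/-- Orthogonality of the martingale differences beyond the stopping time. -/
lemma integral_sq_partialSum_sub_keptSum (h : HasBoundedVariances μ ℱ ξ q p ε) (n : ℕ) :
    ∫ ω, (partialSum n ξ ω - keptSum ξ q n ω) ^ 2 ∂μ =
      ∫ ω, (cumVar (fun j => q j ω) n - keptVar (fun j => q j ω) n) ∂μ := by
  induction n with
  | zero => simp [partialSum, keptSum, cumVar, keptVar]
  | succ n ih =>
    set T : Ω → ℝ := fun ω => partialSum n ξ ω - keptSum ξ q n ω with hT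
    set χ : Ω → ℝ := fun ω => 1 - keep (fun j => q j ω) (n + 1) with hχ
    have hTm : Measurable[ℱ n] T := (h.measurable_partialSum n).sub (h.measurable_keptSum n)
    have hχm : Measurable[ℱ n] χ := measurable_const.sub (h.measurable_keep n)
    have hTL : MemLp T 2 μ := (h.memLp_partialSum n).sub (h.memLp_keptSum n)
    have hχL : MemLp (fun ω => χ ω * ξ (n + 1) ω) 2 μ := by
      have := (h.memLp n).sub (h.memLp_keep_mul n)
      refine this.congr_norm ?_ (ae_of_all _ fun ω => ?_)
      · exact ((hχm.mono (ℱ.le n) le_rfl).mul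
          ((h.measurable n).mono (ℱ.le _) le_rfl)).aestronglyMeasurable
      · simp only [hχ, Pi.sub_apply, sub_mul, one_mul]
    have hχ1 : ∀ ω, |χ ω| ≤ 1 := fun ω => by
      have h1 := keep_nonneg (fun j => q j ω) (n + 1)
      have h2 := keep_le_one (fun j => q j ω) (n + 1)
      rw [hχ, abs_le]
      constructor <;> linarith
    have hcross : ∫ ω, (T ω * χ ω) * ξ (n + 1) ω ∂μ = 0 := by
      have hint : Integrable (fun ω => (T ω * χ ω) * ξ (n + 1) ω) μ := by
        have := hTL.integrable_mul hχL
        refine this.congr (ae_of_all _ fun ω => ?_)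
        simp [mul_assoc]
      rw [integral_mul_condExp (W := fun ω => T ω * χ ω) (ℱ.le n) (hTm.mul hχm) hint
        ((h.memLp n).integrable (by norm_num))]
      refine integral_eq_zero_of_ae ?_
      filter_upwards [h.condExp_eq_zero n] with ω h
      simp [h]
    have hχq : Integrable (fun ω => χ ω * q (n + 1) ω) μ :=
      integrable_bdd_mul (ℱ.le n) hχm hχ1 (h.integrable_var n)
    have hsq : ∫ ω, χ ω * ξ (n + 1) ω ^ 2 ∂μ = ∫ ω, χ ω * q (n + 1) ω ∂μ := by
      rw [integral_mul_condExp (ℱ.le n) hχm (integrable_bdd_mul (ℱ.le n) hχm hχ1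
        (h.memLp n).integrable_sq) (h.memLp n).integrable_sq]
      refine integral_congr_ae ?_
      filter_upwards [h.condExp_sq n] with ω h
      rw [h]
    have hχχ : ∀ ω, χ ω * χ ω = χ ω := fun ω => by
      rcases keep_eq_zero_or_one (fun j => q j ω) (n + 1) with h | h <;> simp [hχ, h]
    have hexp : ∀ ω, (partialSum (n + 1) ξ ω - keptSum ξ q (n + 1) ω) ^ 2 =
        T ω ^ 2 + 2 * ((T ω * χ ω) * ξ (n + 1) ω) + χ ω * ξ (n + 1) ω ^ 2 := fun ω => by
      rw [← hχχ ω, partialSum_succ, keptSum_succ]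
      have : partialSum n ξ ω + ξ (n + 1) ω -
          (keptSum ξ q n ω + keep (fun j => q j ω) (n + 1) * ξ (n + 1) ω) =
          T ω + χ ω * ξ (n + 1) ω := by
        simp only [hT, hχ]
        ring
      rw [this, hχχ ω]
      have h2 : (χ ω * ξ (n + 1) ω) ^ 2 = χ ω * ξ (n + 1) ω ^ 2 := by
        rw [mul_pow, sq (χ ω), hχχ]
      rw [add_sq, h2]
      ring
    have hcross_int : Integrable (fun ω => 2 * ((T ω * χ ω) * ξ (n + 1) ω)) μ := by
      have := (hTL.integrable_mul hχL).const_mul 2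
      refine this.congr (ae_of_all _ fun ω => ?_)
      simp [mul_assoc]
    have hsum_int : Integrable (fun ω => T ω ^ 2 + 2 * ((T ω * χ ω) * ξ (n + 1) ω)) μ :=
      hTL.integrable_sq.add hcross_int
    have hV : Integrable (fun ω => cumVar (fun j => q j ω) n - keptVar (fun j => q j ω) n) μ :=
      (h.integrable_cumVar n).sub (h.integrable_keptVar n)
    simp only [hexp]
    rw [integral_add hsum_int (integrable_bdd_mul (ℱ.le n) hχm hχ1 (h.memLp n).integrable_sq),
      integral_add hTL.integrable_sq hcross_int, integral_const_mul, hcross, hsq, ih, mul_zero,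
      add_zero, ← integral_add hV hχq]
    refine integral_congr_ae (ae_of_all _ fun ω => ?_)
    simp only [cumVar_succ, keptVar_succ, hχ]
    ring

end HasBoundedVariances
end Martingale

/-! ### The bound for the martingale -/

section Conclusion

variable {Ω : Type*} {m : MeasurableSpace Ω} {μ : Measure Ω} [IsProbabilityMeasure μ]
  {ℱ : Filtration ℕ m} {ξ q : ℕ → Ω → ℝ} {ε : ℝ}

lemma HasBoundedVariances.pow_mul_sum_le {ρ K : ℝ} (hρ : 0 < ρ)
    (h : HasBoundedVariances μ ℱ ξ q (min ρ 1) ε) (hε0 : 0 < ε)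
    (hK : ∀ r : ℕ → ℝ, r 0 = 1 + ε ^ 2 → (∀ k, ε ^ 2 ≤ r k) → (∀ k, r (k + 1) ≤ r k) →
      (∀ k, r k - r (k + 1) ≤ ε ^ 2) → ∀ n, ε ^ min ρ 1 *
        ∑ k ∈ Finset.Icc 1 n, (r (k - 1) - r k) * √(r k) ^ (-(1 + min ρ 1)) ≤ K) (n : ℕ) :
    ε ^ min ρ 1 * ∑ k ∈ Finset.Icc 1 n, ∫ ω, keep (fun j => q j ω) k * q k ω *
      remaining q ε k ω ^ (-(1 + min ρ 1)) ∂μ ≤ K := by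
  have hp0 : 0 ≤ min ρ 1 := le_min hρ.le zero_le_one
  have hi : ∀ k ∈ Finset.Icc 1 n, Integrable (fun ω => keep (fun j => q j ω) k * q k ω *
      remaining q ε k ω ^ (-(1 + min ρ 1))) μ := fun k hk => by
    obtain ⟨j, rfl⟩ := Nat.exists_eq_add_of_le' (Finset.mem_Icc.1 hk).1
    exact h.integrable_weight hp0 hε0 j
  rw [← integral_finsetSum _ hi, ← integral_const_mul]
  calc _ ≤ ∫ _, K ∂μ := by
        refine integral_mono ((integrable_finsetSum _ hi).const_mul _) (integrable_const _)
          fun ω => ?_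
        have h0 := fun i => h.var_nonneg i ω
        have h1 := fun i => h.var_le i ω
        have hstep : ∀ k, (1 + ε ^ 2 - keptVar (fun j => q j ω) k) -
            (1 + ε ^ 2 - keptVar (fun j => q j ω) (k + 1)) =
            keep (fun j => q j ω) (k + 1) * q (k + 1) ω := fun k => by
          rw [keptVar_succ]
          ring
        have hk := fun k => mul_nonneg (keep_nonneg (fun j => q j ω) (k + 1)) (h0 (k + 1))
        refine le_trans (le_of_eq ?_) (hK (fun k => 1 + ε ^ 2 - keptVar (fun j => q j ω) k)
          (by simp [keptVar]) (fun k => by linarith [keptVar_le_one h0 h1 k])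
          (fun k => by linarith [hstep k, hk k])
          (fun k => ?_) n)
        · congr 1
          refine Finset.sum_congr rfl fun k hk => ?_
          obtain ⟨j, rfl⟩ := Nat.exists_eq_add_of_le' (Finset.mem_Icc.1 hk).1
          rw [Nat.add_sub_cancel, hstep, remaining]
        · rw [hstep]
          exact (mul_le_of_le_one_left (h0 _) (keep_le_one _ _)).trans (h1 _)
    _ = K := by simp

/-- Stopping costs at most the square root of the deviation of the conditional variance from `1`. -/
lemma HasBoundedVariances.integral_abs_add_remaining_le {p : ℝ}
    (h : HasBoundedVariances μ ℱ ξ q p ε) (hε : 0 < ε) (n : ℕ) :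
    ∫ ω, (|partialSum n ξ ω - keptSum ξ q n ω| + remaining q ε n ω) ∂μ ≤
      2 * √(∫ ω, |cumVar (fun j => q j ω) n - 1| ∂μ) + 3 * ε := by
  set D := ∫ ω, |cumVar (fun j => q j ω) n - 1| ∂μ with hD
  have hD0 : 0 ≤ D := integral_nonneg fun _ => abs_nonneg _
  have hDi : Integrable (fun ω => |cumVar (fun j => q j ω) n - 1|) μ :=
    ((h.integrable_cumVar n).sub (integrable_const 1)).abs
  have hL : MemLp (fun ω => partialSum n ξ ω - keptSum ξ q n ω) 2 μ :=
    (h.memLp_partialSum n).sub (h.memLp_keptSum n)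
  have hR := h.memLp_remaining n
  have h1 : ∫ ω, |partialSum n ξ ω - keptSum ξ q n ω| ∂μ ≤ √D + ε := by
    refine (integral_abs_le_sqrt hL).trans (Real.sqrt_le_iff.2 ⟨by positivity, ?_⟩)
    rw [h.integral_sq_partialSum_sub_keptSum]
    have : ∫ ω, (cumVar (fun j => q j ω) n - keptVar (fun j => q j ω) n) ∂μ ≤
        ∫ ω, (|cumVar (fun j => q j ω) n - 1| + ε ^ 2) ∂μ :=
      integral_mono ((h.integrable_cumVar n).sub (h.integrable_keptVar n))
        (hDi.add (integrable_const _)) fun ω =>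
        cumVar_sub_keptVar_le (fun i => h.var_nonneg i ω) (fun i => h.var_le i ω) n
    rw [integral_add hDi (integrable_const _)] at this
    simp only [integral_const, probReal_univ, one_smul] at this
    nlinarith [Real.sq_sqrt hD0, Real.sqrt_nonneg D]
  have h2 : ∫ ω, remaining q ε n ω ∂μ ≤ √D + 2 * ε := by
    have h3 := integral_abs_le_sqrt hR
    simp only [abs_of_nonneg (Real.sqrt_nonneg _), remaining] at h3
    refine h3.trans (Real.sqrt_le_iff.2 ⟨by positivity, ?_⟩)
    have : ∫ ω, remaining q ε n ω ^ 2 ∂μ ≤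
        ∫ ω, (|cumVar (fun j => q j ω) n - 1| + 2 * ε ^ 2) ∂μ :=
      integral_mono hR.integrable_sq (hDi.add (integrable_const _)) fun ω => by
        have := one_sub_keptVar_le (fun i => h.var_nonneg i ω) (fun i => h.var_le i ω) n
        simp only [h.sq_remaining]
        linarith
    rw [integral_add hDi (integrable_const _)] at this
    simp only [integral_const, probReal_univ, one_smul] at this
    refine this.trans ?_
    nlinarith [Real.sq_sqrt hD0, Real.sqrt_nonneg D]
  rw [integral_add (hL.integrable (by norm_num)).abs (hR.integrable (by norm_num))]
  linarith

lemma HasBoundedVariances.abs_integral_primitive_sub_le {p K : ℝ}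
    (h : HasBoundedVariances μ ℱ ξ q p ε) (hε0 : 0 < ε) (hε1 : ε ≤ 1 / 2) (hp0 : 0 ≤ p)
    (hp1 : p ≤ 1) (n : ℕ) (hK : ε ^ p * ∑ k ∈ Finset.Icc 1 n, ∫ ω,
      keep (fun j => q j ω) k * q k ω * remaining q ε k ω ^ (-(1 + p)) ∂μ ≤ K)
    {g : ℝ → ℝ} (hg : Measurable g) (hb : ∀ x, |g x| ≤ 1) :
    |∫ ω, primitive g (partialSum n ξ ω) ∂μ - ∫ z, primitive g z ∂(gaussianReal 0 1)| ≤
      2 * √(∫ ω, |cumVar (fun j => q j ω) n - 1| ∂μ) + (2 + 2 * gaussMoment p) * K + 4 * ε := by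
  have hX := (h.memLp_partialSum n).integrable (by norm_num : (1 : ℝ≥0∞) ≤ 2)
  have hS := (h.memLp_keptSum n).integrable (by norm_num : (1 : ℝ≥0∞) ≤ 2)
  have hR := (h.memLp_remaining n).integrable (by norm_num : (1 : ℝ≥0∞) ≤ 2)
  have e0 : ∫ z, primitive g z ∂(gaussianReal 0 1) = smooth g 0 1 := by simp [smooth]
  have t1 : |∫ ω, primitive g (partialSum n ξ ω) ∂μ -
      ∫ ω, smooth g (keptSum ξ q n ω) (remaining q ε n ω) ∂μ| ≤
      2 * √(∫ ω, |cumVar (fun j => q j ω) n - 1| ∂μ) + 3 * ε := by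
    refine le_trans ?_ (h.integral_abs_add_remaining_le hε0 n)
    simp only [← smooth_zero_right (g := g)]
    rw [← integral_sub (integrable_smooth hg hb hX (integrable_const 0))
      (integrable_smooth hg hb hS hR), ← Real.norm_eq_abs]
    refine norm_integral_le_of_norm_le ((hX.sub hS).abs.add hR) (ae_of_all _ fun ω => ?_)
    refine (abs_smooth_sub_le hg hb _ _ _ _).trans (le_of_eq ?_)
    rw [zero_sub, abs_neg, abs_of_nonneg (hε0.le.trans (h.le_remaining n ω))]
  have t2 := h.abs_integral_smooth_sub_le hg hb hp0 hp1 hε0 n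
  rw [mul_assoc] at t2
  have t3 : (2 + 2 * gaussMoment p) * (ε ^ p * ∑ k ∈ Finset.Icc 1 n, ∫ ω,
      keep (fun j => q j ω) k * q k ω * remaining q ε k ω ^ (-(1 + p)) ∂μ) ≤
      (2 + 2 * gaussMoment p) * K :=
    mul_le_mul_of_nonneg_left hK (by linarith [gaussMoment_nonneg p])
  have t4 : |smooth g 0 (√(1 + ε ^ 2)) - smooth g 0 1| ≤ ε := by
    refine (abs_smooth_sub_le hg hb _ _ _ _).trans ?_
    rw [sub_self, abs_zero, zero_add,
      abs_of_nonneg (sub_nonneg.2 (Real.one_le_sqrt.2 (by nlinarith)))]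
    have : √(1 + ε ^ 2) ≤ 1 + ε := Real.sqrt_le_iff.2 ⟨by linarith, by nlinarith⟩
    linarith
  rw [e0]
  have t5 := abs_sub_le (∫ ω, primitive g (partialSum n ξ ω) ∂μ)
    (∫ ω, smooth g (keptSum ξ q n ω) (remaining q ε n ω) ∂μ) (smooth g 0 1)
  have t6 := abs_sub_le (∫ ω, smooth g (keptSum ξ q n ω) (remaining q ε n ω) ∂μ)
    (smooth g 0 (√(1 + ε ^ 2))) (smooth g 0 1)
  linarith

/-- A square integrable martingale difference sequence of length `n` is continued by `0`, and its
conditional variances are modified on null sets so as to lie in `[0, ε²]` everywhere. -/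
lemma exists_hasBoundedVariances {n : ℕ} {ρ : ℝ} (hρ : 0 < ρ) (hε : 0 < ε)
    (hξ : IsMartingaleDifference μ ℱ n ξ) (hmom : CondMomentBound μ ℱ n ξ ρ ε) :
    ∃ ξ' q : ℕ → Ω → ℝ, HasBoundedVariances μ ℱ ξ' q (min ρ 1) ε ∧
      partialSum n ξ' = partialSum n ξ ∧
      ∀ᵐ ω ∂μ, cumVar (fun j => q j ω) n = condVariance μ ℱ n ξ ω := by
  -- `q i` is measurable with respect to `ℱ (i - 1)`, which is what makes stopping predictable.
  -- `q i` is measurable with respect to `ℱ (i - 1)`, which is what makes stopping predictable.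
  set ξ' : ℕ → Ω → ℝ := fun i => if i ∈ Finset.Icc 1 n then ξ i else 0 with hξ'
  -- Clamping keeps `q i` measurable with respect to `ℱ (i - 1)`, so that the stopping rule built
  -- from `q` is predictable.
  set q : ℕ → Ω → ℝ := fun i ω =>
    max 0 (min ((μ[fun ω' => ξ' i ω' ^ 2 | ℱ (i - 1)]) ω) (ε ^ 2)) with hq
  have hp0 : 0 ≤ min ρ 1 := le_min hρ.le zero_le_one
  have hin : ∀ i ∈ Finset.Icc 1 n, ξ' i = ξ i := fun i hi => if_pos hi
  have hout : ∀ i ∉ Finset.Icc 1 n, ξ' i = 0 := fun i hi => if_neg hi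
  have hL : ∀ i, MemLp (ξ' i) 2 μ := fun i => by
    by_cases hi : i ∈ Finset.Icc 1 n
    · rw [hin i hi]
      exact hξ.sq_integrable i hi
    · rw [hout i hi]
      exact MemLp.zero
  have hreal : ∀ i, Integrable (fun ω => |ξ' i ω| ^ (2 + ρ)) μ ∧
      ∀ᵐ ω ∂μ, (μ[fun ω => |ξ' i ω| ^ (2 + ρ) | ℱ (i - 1)]) ω ≤
        ε ^ ρ * (μ[fun ω => ξ' i ω ^ 2 | ℱ (i - 1)]) ω := fun i => by
    by_cases hi : i ∈ Finset.Icc 1 n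
    · rw [hin i hi]
      exact condExp_abs_rpow_le (ℱ.le _) (hξ.sq_integrable i hi) hρ hε (hmom i hi)
    · have e1 : (fun ω => |ξ' i ω| ^ (2 + ρ)) = 0 := by
        ext ω
        simp [hout i hi, Real.zero_rpow (by linarith : (2 + ρ) ≠ 0)]
      have e2 : (fun ω => ξ' i ω ^ 2) = 0 := by
        ext ω
        simp [hout i hi]
      rw [e1, e2, condExp_zero]
      exact ⟨integrable_zero _ _ _, by simp⟩
  have hle := fun i => condExp_sq_le (ℱ.le (i - 1)) (hL i) hρ hε (hreal i).1 (hreal i).2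
  have hqe : ∀ i, μ[fun ω => ξ' i ω ^ 2 | ℱ (i - 1)] =ᵐ[μ] q i := fun i => by
    have hnn : 0 ≤ᵐ[μ] μ[fun ω => ξ' i ω ^ 2 | ℱ (i - 1)] :=
      condExp_nonneg (ae_of_all _ fun ω => sq_nonneg _)
    filter_upwards [hle i, hnn] with ω h1 h2
    rw [Pi.zero_apply] at h2
    simp only [hq]
    rw [min_eq_left h1, max_eq_right h2]
  have hint := fun i => condExp_abs_rpow_interpolation (hL i) hρ hε hp0 (min_le_left ρ 1)
    (hreal i).1 (hreal i).2
  refine ⟨ξ', q, ⟨fun k => ?_, fun k => hL _, fun k => ?_, fun k => ?_, fun k ω => le_max_left _ _,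
    fun k ω => max_le (sq_nonneg _) (min_le_right _ _), fun k => hqe (k + 1),
    fun k => (hint (k + 1)).1, fun k => ?_⟩, ?_, ?_⟩
  · by_cases hi : k + 1 ∈ Finset.Icc 1 n
    · rw [hin _ hi]
      exact hξ.measurable _ hi
    · rw [hout _ hi]
      exact measurable_const
  · by_cases hi : k + 1 ∈ Finset.Icc 1 n
    · rw [hin _ hi]
      exact hξ.condExp_eq_zero _ hi
    · rw [hout _ hi, condExp_zero]
  · exact measurable_const.max (stronglyMeasurable_condExp.measurable.min measurable_const)
  · filter_upwards [(hint (k + 1)).2, hqe (k + 1)] with ω h1 h2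
    rw [← h2]
    exact h1
  · ext ω
    exact Finset.sum_congr rfl fun i hi => by rw [hin i hi]
  · have hall : ∀ᵐ ω ∂μ, ∀ i, (μ[fun ω => ξ' i ω ^ 2 | ℱ (i - 1)]) ω = q i ω := ae_all_iff.2 hqe
    filter_upwards [hall] with ω h
    refine Finset.sum_congr rfl fun i hi => ?_
    dsimp only
    rw [← h i, hin i hi]

/-- Jensen's inequality for the deviation of the conditional variance. -/
lemma ofReal_sqrt_integral_abs_le {Y : Ω → ℝ} {t : ℝ} (ht : 1 ≤ t) (hY : Integrable Y μ) :
    ENNReal.ofReal (√(∫ ω, |Y ω| ∂μ)) ≤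
      (∫⁻ ω, ENNReal.ofReal (|Y ω| ^ t) ∂μ) ^ (1 / (2 * t)) := by
  have ht0 : 0 < t := by linarith
  have h := eLpNorm_le_eLpNorm_of_exponent_le (μ := μ) (p := 1) (q := ENNReal.ofReal t)
    (by simpa using ENNReal.ofReal_le_ofReal ht) hY.1
  rw [eLpNorm_one_eq_lintegral_enorm, eLpNorm_eq_lintegral_rpow_enorm_toReal (by simpa using ht0)
    (by simp), ENNReal.toReal_ofReal ht0.le, ← ofReal_integral_norm_eq_lintegral_enorm hY] at h
  have e : ∀ ω, ‖Y ω‖ₑ ^ t = ENNReal.ofReal (|Y ω| ^ t) := fun ω => by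
    rw [Real.enorm_eq_ofReal_abs, ENNReal.ofReal_rpow_of_nonneg (abs_nonneg _) ht0.le]
  simp only [e, Real.norm_eq_abs] at h
  have h2 := ENNReal.rpow_le_rpow h (by norm_num : (0 : ℝ) ≤ 1 / 2)
  rw [ENNReal.ofReal_rpow_of_nonneg (integral_nonneg fun _ => abs_nonneg _) (by norm_num),
    ← Real.sqrt_eq_rpow, ← ENNReal.rpow_mul] at h2
  refine h2.trans (le_of_eq ?_)
  congr 1
  field_simp

end Conclusion

end MartingaleCLT

end

theorem lemma2p4 (t ρ : ℝ) (ht : 1 ≤ t) (hρ : 0 < ρ) :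
    ∃ C : ℝ, 0 < C ∧
      ∀ {Ω : Type*} {m : MeasurableSpace Ω} (μ : Measure Ω) [IsProbabilityMeasure μ]
        (ℱ : Filtration ℕ m) (n : ℕ) (ξ : ℕ → Ω → ℝ) (ε : ℝ),
        1 ≤ n → 0 < ε → ε ≤ 1 / 2 →
        MartingaleCLT.IsMartingaleDifference μ ℱ n ξ →
        MartingaleCLT.CondMomentBound μ ℱ n ξ ρ ε →
        MartingaleCLT.normalDist μ (MartingaleCLT.partialSum n ξ) ≤
          ENNReal.ofReal C *
            (ENNReal.ofReal (MartingaleCLT.epsHat ρ ε) +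
              ((∫⁻ ω, ENNReal.ofReal (|MartingaleCLT.condVariance μ ℱ n ξ ω - 1| ^ t) ∂μ) +
                ∫⁻ ω, (Finset.Icc 1 n).sup (fun i => ‖ξ i ω‖ₑ ^ (2 * t)) ∂μ) ^
                (1 / (2 * t))) := by
  obtain ⟨K, hK0, hK⟩ := MartingaleCLT.exists_sum_weight_le hρ
  have hM := MartingaleCLT.gaussMoment_nonneg (min ρ 1)
  have hp0 : 0 ≤ min ρ 1 := le_min hρ.le zero_le_one
  set C := (2 + 2 * MartingaleCLT.gaussMoment (min ρ 1)) * K + 8 with hC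
  have hC8 : 8 ≤ C := by
    have : 0 ≤ (2 + 2 * MartingaleCLT.gaussMoment (min ρ 1)) * K := by positivity
    linarith
  refine ⟨C, by linarith, ?_⟩
  intro Ω m μ _ ℱ n ξ ε _ hε0 hε1 hξ hmom
  obtain ⟨ξ', q, h, hsum, hvar⟩ :=
    MartingaleCLT.exists_hasBoundedVariances hρ hε0 hξ hmom
  have hXm : AEMeasurable (MartingaleCLT.partialSum n ξ) μ :=
    hsum ▸ (h.memLp_partialSum n).1.aemeasurable
  have hXi : Integrable (MartingaleCLT.partialSum n ξ) μ :=
    hsum ▸ (h.memLp_partialSum n).integrable (by norm_num)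
  have : IsProbabilityMeasure (μ.map (MartingaleCLT.partialSum n ξ)) :=
    Measure.isProbabilityMeasure_map hXm
  have hlaw : Integrable (fun x : ℝ => x) (μ.map (MartingaleCLT.partialSum n ξ)) :=
    (integrable_map_measure (by fun_prop) hXm).2 hXi
  obtain ⟨g, hg, hb, hdist⟩ := MartingaleCLT.exists_primitive_lintegral_cdf_sub hlaw
    MartingaleCLT.integrable_id_gauss
  have hcv : Integrable (fun ω => MartingaleCLT.condVariance μ ℱ n ξ ω - 1) μ :=
    ((h.integrable_cumVar n).congr hvar).sub (integrable_const 1)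
  have hD : ∫ ω, |MartingaleCLT.cumVar (fun j => q j ω) n - 1| ∂μ =
      ∫ ω, |MartingaleCLT.condVariance μ ℱ n ξ ω - 1| ∂μ :=
    integral_congr_ae (hvar.mono fun ω hω => by simp only [hω])
  have hmain := h.abs_integral_primitive_sub_le hε0 hε1 hp0 (min_le_right _ _) n
    (h.pow_mul_sum_le hρ hε0 (hK ε hε0 hε1) n) hg hb
  rw [hD, hsum] at hmain
  have heps := MartingaleCLT.le_epsHat (ρ := ρ) hε0 hε1
  have heps0 := MartingaleCLT.epsHat_nonneg (ρ := ρ) hε0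
  rw [MartingaleCLT.normalDist, hdist, integral_map hXm
    (MartingaleCLT.continuous_primitive hg hb).aestronglyMeasurable]
  calc _ ≤ ENNReal.ofReal (C * (MartingaleCLT.epsHat ρ ε +
          √(∫ ω, |MartingaleCLT.condVariance μ ℱ n ξ ω - 1| ∂μ))) := by
        refine ENNReal.ofReal_le_ofReal ?_
        rw [abs_sub_comm] at hmain
        have h1 := (le_abs_self _).trans hmain
        have h2 := Real.sqrt_nonneg (∫ ω, |MartingaleCLT.condVariance μ ℱ n ξ ω - 1| ∂μ)
        rw [mul_add]
        have h3 : C * MartingaleCLT.epsHat ρ ε = (2 + 2 * MartingaleCLT.gaussMoment (min ρ 1)) *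
            (K * MartingaleCLT.epsHat ρ ε) + 8 * MartingaleCLT.epsHat ρ ε := by
          rw [hC]
          ring
        nlinarith
    _ ≤ _ := by
        rw [ENNReal.ofReal_mul (by linarith), ENNReal.ofReal_add heps0 (Real.sqrt_nonneg _)]
        gcongr
        -- The maximal term only enlarges the right-hand side.
        refine (MartingaleCLT.ofReal_sqrt_integral_abs_le ht hcv).trans ?_
        have : 0 ≤ 1 / (2 * t) := by positivity
        gcongr
        exact le_self_add
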